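/- Setting. Let $\eta=\mathrm{diag}(1,-1,-1,-1)$ be the Minkowski metric, and let $\mathcal W$ be the algebra (over $\mathbb C$, under the normal product) of Wick polynomials at a point in the free massless fields $h^{\mu\nu}=h^{\nu\mu}$ (Bose tensor field), $u^\mu$ (Fermi ghost field) and $\tilde u^\mu$ (Fermi anti-ghost field). That is, $\mathcal W$ is the graded commutative algebra generated by all partial derivatives of the components of these fields, subject only to the symmetry of $h$ and to the wave equations $\Box h^{\mu\nu}=\Box u^\mu=\Box\tilde u^\mu=0$. Write $\varphi_{,\mu}=\partial_\mu\varphi$ and $h=\eta_{\mu\nu}h^{\mu\nu}$; repeated upper indices are contracted with $\eta$. The ghost number $n_g$ is the number of factors $u$ minus the number of factors $\tilde u$. The gauge variation $d_Q$ is the linear map on $\mathcal W$ that commutes with all $\partial_\mu$, satisfies $d_Q(AB)=(d_QA)B+(-1)^{n_g(A)}A\,d_QB$, and is given by $$d_Qh^{\mu\nu}=-\tfrac i2\bigl(\partial^\nu u^\mu+\partial^\mu u^\nu-\eta^{\mu\nu}\partial_\alpha u^\alpha\bigr),\qquad d_Qu^\mu=0,\qquad d_Q\tilde u^\mu=i\,\partial_\nu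 h^{\mu\nu}.$$ A divergence is an element $\partial_\mu W^\mu$ with $W^\mu\in\mathcal W$. An element $T\in\mathcal W$ is gauge invariant to first order if $d_QT=i\,\partial_\mu T_{1/1}^\mu$ for some $T_{1/1}^\mu\in\mathcal W$. Two elements are physically equivalent to first order if their difference is $d_QX$ plus a divergence, for some $X\in\mathcal W$ of ghost number $-1$. For $c=(a_1,\dots,a_{12},b_1,\dots,b_{21})\in\mathbb R^{33}$ let $T_1(c)=T_1^h+T_1^u$, where $$T_1^h=a_{1} h^{\mu\nu}_{,\mu}h_{,\nu}h+a_{2} h^{\mu\nu}h_{,\mu}h_{,\nu}+a_{3} h^{\alpha\beta}_{,\alpha}h^{\beta\mu}_{,\mu}h+a_{4} h^{\alpha\beta}_{,\alpha}h^{\beta\mu}h_{,\mu}+a_{5} h^{\alpha\beta}h^{\beta\mu}_{,\alpha}h_{,\mu}+a_{6} h^{\alpha\beta}_{,\mu}h^{\beta\mu}_{,\alpha}h+a_{7} h^{\mu\nu}_{,\mu}h^{\alpha\beta}_{,\nu}h^{\alpha\beta}+a_{8} h^{\mu\nu}h^{\alpha\beta}_{,\mu}h^{\alpha\beta}_{,\nu}+a_{9}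 h^{\mu\nu}_{,\alpha}h^{\nu\alpha}_{,\beta}h^{\mu\beta}+a_{10} h^{\mu\nu}_{,\alpha}h^{\nu\alpha}h^{\mu\beta}_{,\beta}+a_{11} h^{\mu\nu}h^{\nu\alpha}_{,\alpha}h^{\mu\beta}_{,\beta}+a_{12} h^{\mu\nu}h^{\nu\alpha}_{,\beta}h^{\mu\beta}_{,\alpha}$$ and $$T_1^u=b_{1} u^{\rho}_{,\nu}\tilde u^{\mu}_{,\rho}h^{\mu\nu}+b_{2} u^{\rho}_{,\nu}\tilde u^{\mu}h^{\mu\nu}_{,\rho}+b_{3} u^{\rho}\tilde u^{\mu}_{,\nu}h^{\mu\nu}_{,\rho}+b_{4} u^{\rho}_{,\rho}\tilde u^{\mu}_{,\nu}h^{\mu\nu}+b_{5} u^{\rho}_{,\rho}\tilde u^{\mu}h^{\mu\nu}_{,\nu}+b_{6} u^{\rho}\tilde u^{\mu}_{,\rho}h^{\mu\nu}_{,\nu}+b_{7} u^{\rho}_{,\mu}\tilde u^{\mu}_{,\rho}h+b_{8} u^{\rho}_{,\mu}\tilde u^{\mu}h_{,\rho}+b_{9} u^{\rho}\tilde u^{\mu}_{,\mu}h_{,\rho}+b_{10}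 u^{\rho}_{,\rho}\tilde u^{\mu}_{,\mu}h+b_{11} u^{\rho}_{,\rho}\tilde u^{\mu}h_{,\mu}+b_{12} u^{\rho}\tilde u^{\mu}_{,\rho}h_{,\mu}+b_{13} u^{\rho}_{,\mu}\tilde u^{\mu}_{,\nu}h^{\rho\nu}+b_{14} u^{\rho}_{,\mu}\tilde u^{\mu}h^{\rho\nu}_{,\nu}+b_{15} u^{\rho}\tilde u^{\mu}_{,\mu}h^{\rho\nu}_{,\nu}+b_{16} u^{\rho}_{,\nu}\tilde u^{\mu}_{,\mu}h^{\rho\nu}+b_{17} u^{\rho}_{,\nu}\tilde u^{\mu}h^{\rho\nu}_{,\mu}+b_{18} u^{\rho}\tilde u^{\mu}_{,\nu}h^{\rho\nu}_{,\mu}+b_{19} u^{\mu}_{,\nu}\tilde u^{\mu}_{,\rho}h^{\rho\nu}+b_{20} u^{\mu}_{,\nu}\tilde u^{\mu}h^{\rho\nu}_{,\rho}+b_{21} u^{\mu}\tilde u^{\mu}_{,\nu}h^{\rho\nu}_{,\rho}.$$ Let $V\subset\mathbb R^{33}$ be the subspace of all $c$ for which $T_1(c)$ is gauge invariant to first order.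 For $\kappa\in\mathbb R$ let $T^{EH}_\kappa$ be the trilinear Einstein–Hilbert coupling with the Kugo–Ojima ghost coupling, $$T^{EH}_\kappa=\kappa\bigl[-\tfrac14h^{\mu\nu}h_{,\mu}h_{,\nu}+\tfrac12h^{\mu\nu}h^{\alpha\beta}_{,\mu}h^{\alpha\beta}_{,\nu}+h^{\mu\nu}h^{\nu\alpha}_{,\beta}h^{\mu\beta}_{,\alpha}\bigr]+\kappa\bigl[u^\rho_{,\nu}\tilde u^\mu_{,\rho}h^{\mu\nu}-u^\rho\tilde u^\mu_{,\nu}h^{\mu\nu}_{,\rho}-u^\rho_{,\rho}\tilde u^\mu_{,\nu}h^{\mu\nu}+u^\mu_{,\nu}\tilde u^\mu_{,\rho}h^{\rho\nu}\bigr],$$ so that $T^{EH}_1=T_1(v_{EH})$ for the vector $v_{EH}=-\tfrac{1}{4}e_{a_{2}}+\tfrac{1}{2}e_{a_{8}}+e_{a_{12}}+e_{b_{1}}-e_{b_{3}}-e_{b_{4}}+e_{b_{19}}$, where $e_{a_j},e_{b_j}$ denotes the standard basis of $\mathbb R^{33}$. Proposition 2. Every gauge invariant coupling $T_1(c)$,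 $c\in V$, is physically equivalent to first order to the Einstein–Hilbert coupling with Kugo–Ojima ghost coupling $T^{EH}_\kappa$, for some value $\kappa\in\mathbb R$ (possibly $0$) of the coupling constant. More precisely, $(v_1,\dots,v_{17},v_{EH})$ is a basis of $V$, where $$\begin{aligned} v_{1}&=-e_{a_{3}}-e_{a_{4}}+e_{a_{5}}+e_{a_{6}},\\ v_{2}&=e_{a_{9}}-e_{a_{10}}-e_{a_{11}}+e_{a_{12}},\\ v_{3}&=e_{b_{2}}+e_{b_{3}}+e_{b_{6}},\\ v_{4}&=-e_{b_{1}}-e_{b_{2}}+e_{b_{4}}+e_{b_{5}},\\ v_{5}&=e_{b_{5}}+2e_{b_{6}},\\ v_{6}&=e_{a_{3}}+e_{b_{5}},\\ v_{7}&=e_{b_{7}}+e_{b_{8}}-e_{b_{10}}-e_{b_{11}},\\ v_{8}&=2e_{a_{4}}-2e_{b_{1}}-2e_{b_{2}}+e_{b_{7}}-e_{b_{10}},\\ v_{9}&=-e_{a_{1}}+e_{b_{10}},\\ v_{10}&=e_{b_{7}}-e_{b_{9}}-e_{b_{10}}+e_{b_{12}},\\ v_{11}&=-\tfrac{3}{2}e_{a_{3}}+e_{a_{9}}+e_{a_{10}}+e_{a_{11}}+e_{a_{12}}-2e_{b_{2}}-e_{b_{3}}-e_{b_{4}}+e_{b_{13}}+e_{b_{19}},\\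 v_{12}&=e_{b_{14}}+e_{b_{15}}+e_{b_{21}},\\ v_{13}&=e_{b_{14}}-e_{b_{20}},\\ v_{14}&=\tfrac{1}{2}e_{a_{3}}-e_{a_{9}}+e_{a_{10}}-e_{a_{12}}+e_{b_{20}},\\ v_{15}&=-e_{b_{13}}+e_{b_{15}}+e_{b_{16}}-e_{b_{18}},\\ v_{16}&=-\tfrac{1}{2}e_{a_{1}}+e_{a_{7}}+e_{b_{16}},\\ v_{17}&=e_{b_{15}}-e_{b_{17}}-e_{b_{18}}+e_{b_{20}}, \end{aligned}$$ and for every $i=1,\dots,17$ the coupling $T_1(v_i)$ is the sum of a coboundary $d_QX_i$ and a divergence, where $X_i$ is a linear combination of Wick monomials with one derivative of the form $\tilde uhh$ or $u\tilde u\tilde u$. -/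

import Mathlib

/-!
Wick polynomials of the free massless fields `h^{μν}`, `u^μ`, `ũ^μ` on Minkowski space, taken at
one spacetime point.  Under the normal product they form the graded commutative algebra generated
by the partial derivatives of all orders of the field components, subject only to the symmetry of
`h` and to the wave equation.
-/

noncomputable section

namespace SpinTwo

/-- Minkowski metric `η = diag(1, -1, -1, -1)`: the diagonal entries `η_{μμ} = η^{μμ}`. -/
def eta (μ : Fin 4) : ℂ := if μ = 0 then 1 else -1

/-- Components of the fundamental fields: the tensor field `h^{μν}`, the ghost field `u^μ` and the
anti-ghost field `ũ^μ` (all tensor indices are upper indices). -/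
inductive Component : Type
  | h (μ ν : Fin 4)
  | u (μ : Fin 4)
  | ut (μ : Fin 4)

namespace Component

/-- Ghost fields are Fermi fields (`true`), the tensor field is a Bose field (`false`). -/
def odd : Component → Bool
  | h _ _ => false
  | u _ => true
  | ut _ => true

/-- Ghost number. -/
def ghost : Component → ℤ
  | h _ _ => 0
  | u _ => 1
  | ut _ => -1

end Component

/-- A partial derivative `φ_{,μ₁…μₖ}` of a component `φ`; partial derivatives commute, so
`{μ₁, …, μₖ}` is a multiset. -/
structure Jet : Type where
  comp : Component
  derivs : Multiset (Fin 4)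

/-- The sign `(-1)^{pq}` of exchanging two objects of parities `p`, `q`. -/
def sgn (p q : Bool) : ℂ := if p && q then -1 else 1

/-- The relations among derivatives of free fields under the normal product. -/
inductive FieldRel : FreeAlgebra ℂ Jet → FreeAlgebra ℂ Jet → Prop
  | symm (μ ν : Fin 4) (I : Multiset (Fin 4)) :
      FieldRel (FreeAlgebra.ι ℂ ⟨.h μ ν, I⟩) (FreeAlgebra.ι ℂ ⟨.h ν μ, I⟩)
  | wave (φ : Component) (I : Multiset (Fin 4)) :
      FieldRel (∑ μ : Fin 4, eta μ • FreeAlgebra.ι ℂ ⟨φ, μ ::ₘ μ ::ₘ I⟩) 0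
  | comm (a b : Jet) :
      FieldRel (FreeAlgebra.ι ℂ a * FreeAlgebra.ι ℂ b)
        (sgn a.comp.odd b.comp.odd • (FreeAlgebra.ι ℂ b * FreeAlgebra.ι ℂ a))

/-- The algebra of Wick polynomials; multiplication is the normal product. -/
abbrev Wick : Type := RingQuot FieldRel

/-- The Wick polynomial consisting of one differentiated field component. -/
def gen (a : Jet) : Wick := RingQuot.mkAlgHom ℂ FieldRel (FreeAlgebra.ι ℂ a)

theorem gen_symm (μ ν : Fin 4) (I : Multiset (Fin 4)) :
    gen ⟨.h μ ν, I⟩ = gen ⟨.h ν μ, I⟩ :=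
  RingQuot.mkAlgHom_rel ℂ (FieldRel.symm μ ν I)

theorem gen_wave (φ : Component) (I : Multiset (Fin 4)) :
    ∑ μ : Fin 4, eta μ • gen ⟨φ, μ ::ₘ μ ::ₘ I⟩ = 0 := by
  have := RingQuot.mkAlgHom_rel ℂ (FieldRel.wave φ I)
  simp only [map_sum, map_smul, map_zero] at this
  exact this

theorem gen_comm (a b : Jet) :
    gen a * gen b = sgn a.comp.odd b.comp.odd • (gen b * gen a) := by
  have := RingQuot.mkAlgHom_rel ℂ (FieldRel.comm a b)
  simp only [map_mul, map_smul] at this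
  exact this

/-! ### Graded derivations -/

theorem sgn_comm (p q : Bool) : sgn p q = sgn q p := by
  cases p <;> cases q <;> rfl

theorem sgn_mul_self (p q : Bool) : sgn p q * sgn p q = 1 := by
  cases p <;> cases q <;> simp [sgn]

theorem sgn_xor (p q r : Bool) : sgn p (xor q r) = sgn p q * sgn p r := by
  cases p <;> cases q <;> cases r <;> simp [sgn]

/-- Auxiliary homomorphism `F ↦ [[γ F, D F], [0, F]]`, where `γ` multiplies by `(-1)^{p|F|}` and
`D` is the graded derivation of parity `p` with the prescribed values `δ` on the generators. -/
def derivMat (p : Bool) (δ : Jet → Wick) : FreeAlgebra ℂ Jet →ₐ[ℂ] Matrix (Fin 2) (Fin 2) Wick :=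
  FreeAlgebra.lift ℂ fun a => !![sgn p a.comp.odd • gen a, δ a; 0, gen a]

theorem derivMat_ι (p : Bool) (δ : Jet → Wick) (a : Jet) :
    derivMat p δ (FreeAlgebra.ι ℂ a) = !![sgn p a.comp.odd • gen a, δ a; 0, gen a] := by
  simp [derivMat]

/-- Conditions on prescribed values `δ` that make them extend to the quotient algebra. -/
structure Admissible (p : Bool) (δ : Jet → Wick) : Prop where
  symm : ∀ μ ν I, δ ⟨.h μ ν, I⟩ = δ ⟨.h ν μ, I⟩
  wave : ∀ φ I, ∑ μ : Fin 4, eta μ • δ ⟨φ, μ ::ₘ μ ::ₘ I⟩ = 0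
  comm : ∀ a b, gen a * δ b = sgn a.comp.odd (xor p b.comp.odd) • (δ b * gen a)

theorem derivMat_rel {p : Bool} {δ : Jet → Wick} (H : Admissible p δ)
    ⦃x y : FreeAlgebra ℂ Jet⦄ (r : FieldRel x y) : derivMat p δ x = derivMat p δ y := by
  cases r with
  | symm μ ν I =>
    rw [derivMat_ι, derivMat_ι, gen_symm, H.symm]; rfl
  | wave φ I =>
    simp only [map_sum, map_smul, derivMat_ι, map_zero]
    have h1 := gen_wave φ I
    have h2 := H.wave φ I
    ext i j
    fin_cases i <;> fin_cases j <;>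
      simp only [Matrix.sum_apply, Matrix.smul_apply, Matrix.of_apply, Matrix.cons_val',
        Matrix.cons_val_zero, Matrix.cons_val_one, Matrix.cons_val_fin_one, Fin.zero_eta,
        Fin.mk_one, Fin.isValue, Matrix.zero_apply, smul_zero, Finset.sum_const_zero, h1, h2]
    simp only [smul_comm (eta _) (sgn p φ.odd)]
    rw [← Finset.smul_sum, h1, smul_zero]
  | comm a b =>
    rw [map_smul, map_mul, map_mul, derivMat_ι, derivMat_ι, Matrix.mul_fin_two,
      Matrix.mul_fin_two]
    have h1 := gen_comm a b
    have h2 := H.comm a b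
    have h3 : δ a * gen b = sgn b.comp.odd (xor p a.comp.odd) • (gen b * δ a) := by
      rw [H.comm b a, smul_smul, sgn_mul_self, one_smul]
    ext i j
    fin_cases i <;> fin_cases j
    · simp only [Fin.zero_eta, Fin.isValue, Matrix.smul_apply, Matrix.of_apply,
        Matrix.cons_val', Matrix.cons_val_zero, Matrix.cons_val_fin_one, mul_zero, add_zero,
        smul_mul_smul_comm]
      rw [h1, smul_smul, smul_smul]
      congr 1
      ring
    · simp only [Fin.zero_eta, Fin.mk_one, Fin.isValue, Matrix.smul_apply, Matrix.of_apply,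
        Matrix.cons_val', Matrix.cons_val_zero, Matrix.cons_val_one, Matrix.cons_val_fin_one,
        smul_mul_assoc]
      rw [h2, h3, smul_add, smul_smul, smul_smul, add_comm, sgn_xor, sgn_xor,
        sgn_comm b.comp.odd a.comp.odd, sgn_comm b.comp.odd p, sgn_comm a.comp.odd p]
      congr 2
      · ring
      · rw [← mul_assoc, sgn_mul_self, one_mul]
    · simp
    · simpa using h1

/-- The graded derivation of parity `p` with values `δ` on the generators: the linear map `D` with
`D (gen a) = δ a` and `D (F G) = (D F) G + (-1)^{p|F|} F (D G)`. -/
def gradedDerivation (p : Bool) (δ : Jet → Wick) (H : Admissible p δ) : Wick →ₗ[ℂ] Wick :=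
  Matrix.entryLinearMap ℂ Wick 0 1 ∘ₗ
    (RingQuot.liftAlgHom ℂ ⟨derivMat p δ, derivMat_rel H⟩).toLinearMap

theorem gradedDerivation_one (p : Bool) (δ : Jet → Wick) (H : Admissible p δ) :
    gradedDerivation p δ H 1 = 0 := by
  simp [gradedDerivation]

/-- The prescribed value and the graded Leibniz rule for a product that starts with a generator;
these determine `D`, since the generators generate the algebra. -/
theorem gradedDerivation_gen_mul (p : Bool) (δ : Jet → Wick) (H : Admissible p δ)
    (a : Jet) (F : Wick) :
    gradedDerivation p δ H (gen a * F) =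
      δ a * F + sgn p a.comp.odd • (gen a * gradedDerivation p δ H F) := by
  have key : ∀ x : FreeAlgebra ℂ Jet,
      RingQuot.liftAlgHom ℂ ⟨derivMat p δ, derivMat_rel H⟩ (RingQuot.mkAlgHom ℂ FieldRel x) 1 1 =
        RingQuot.mkAlgHom ℂ FieldRel x := by
    intro x
    rw [RingQuot.liftAlgHom_mkAlgHom_apply]
    have low : ∀ y : FreeAlgebra ℂ Jet, derivMat p δ y 1 0 = 0 ∧
        derivMat p δ y 1 1 = RingQuot.mkAlgHom ℂ FieldRel y := by
      intro y
      induction y using FreeAlgebra.induction with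
      | grade0 r => simp [Matrix.algebraMap_eq_diagonal]
      | grade1 b => rw [derivMat_ι]; simp [gen]
      | mul y z hy hz => simp [Matrix.mul_apply, Fin.sum_univ_two, hy.1, hy.2, hz.1, hz.2]
      | add y z hy hz => simp [hy.1, hy.2, hz.1, hz.2]
    exact (low x).2
  obtain ⟨x, rfl⟩ := RingQuot.mkAlgHom_surjective ℂ FieldRel F
  have hx := key x
  simp only [gradedDerivation, LinearMap.comp_apply, AlgHom.toLinearMap_apply, map_mul,
    Matrix.entryLinearMap_apply] at hx ⊢
  rw [Matrix.mul_apply, Fin.sum_univ_two, hx, gen, RingQuot.liftAlgHom_mkAlgHom_apply,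
    derivMat_ι, add_comm]
  simp [gen]

/-! ### Partial derivatives -/

/-- `∂_μ` on a differentiated field component. -/
def partialGen (μ : Fin 4) (a : Jet) : Wick := gen ⟨a.comp, μ ::ₘ a.derivs⟩

theorem partialGen_admissible (μ : Fin 4) : Admissible false (partialGen μ) where
  symm α β I := gen_symm α β (μ ::ₘ I)
  wave φ I := by
    have := gen_wave φ (μ ::ₘ I)
    simpa only [partialGen, Multiset.cons_swap μ] using this
  comm a b := by
    simpa only [partialGen, Bool.false_xor] using gen_comm a ⟨b.comp, μ ::ₘ b.derivs⟩

/-- The partial derivative `∂_μ = ∂/∂x^μ` of Wick polynomials. -/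
def pd (μ : Fin 4) : Wick →ₗ[ℂ] Wick :=
  gradedDerivation false (partialGen μ) (partialGen_admissible μ)

/-! ### Gauge variation -/

/-- Gauge variations of the (differentiated) fields:
`d_Q h^{μν} = -(i/2) (∂^ν u^μ + ∂^μ u^ν - η^{μν} ∂_α u^α)`, `d_Q u^μ = 0`,
`d_Q ũ^μ = i ∂_ν h^{μν}`; the gauge variation commutes with partial derivatives. -/
def gaugeGen : Jet → Wick
  | ⟨.h μ ν, I⟩ => (-(Complex.I / 2)) •
      (eta ν • gen ⟨.u μ, ν ::ₘ I⟩ + eta μ • gen ⟨.u ν, μ ::ₘ I⟩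
        - (if μ = ν then eta μ else 0) • ∑ α : Fin 4, gen ⟨.u α, α ::ₘ I⟩)
  | ⟨.u _, _⟩ => 0
  | ⟨.ut μ, I⟩ => Complex.I • ∑ ν : Fin 4, gen ⟨.h μ ν, ν ::ₘ I⟩

theorem gaugeGen_admissible : Admissible true gaugeGen where
  symm μ ν I := by
    simp only [gaugeGen]
    rcases eq_or_ne μ ν with rfl | hne
    · rfl
    · rw [if_neg hne, if_neg hne.symm, add_comm (eta ν • _)]
  wave φ I := by
    have key : ∀ (ψ : Component) (β : Fin 4),
        ∑ μ : Fin 4, eta μ • gen ⟨ψ, β ::ₘ μ ::ₘ μ ::ₘ I⟩ = 0 := by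
      intro ψ β
      have := gen_wave ψ (β ::ₘ I)
      simpa only [Multiset.cons_swap β] using this
    cases φ with
    | h μ ν =>
      simp only [gaugeGen]
      simp only [smul_comm (eta _) (-(Complex.I / 2))]
      rw [← Finset.smul_sum]
      simp only [smul_sub, smul_add, Finset.sum_sub_distrib, Finset.sum_add_distrib]
      have e1 : ∀ (c : ℂ) (ψ : Component) (β : Fin 4),
          ∑ x : Fin 4, eta x • c • gen ⟨ψ, β ::ₘ x ::ₘ x ::ₘ I⟩ = 0 := by
        intro c ψ β
        simp only [smul_comm (eta _) c]
        rw [← Finset.smul_sum, key, smul_zero]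
      rw [e1, e1]
      have e2 : ∑ x : Fin 4, eta x • (if μ = ν then eta μ else 0) •
          ∑ α : Fin 4, gen ⟨.u α, α ::ₘ x ::ₘ x ::ₘ I⟩ = 0 := by
        simp only [Finset.smul_sum]
        rw [Finset.sum_comm]
        exact Finset.sum_eq_zero fun α _ => e1 _ _ _
      rw [e2]
      simp
    | u μ => simp [gaugeGen]
    | ut μ =>
      simp only [gaugeGen, Finset.smul_sum]
      rw [Finset.sum_comm]
      refine Finset.sum_eq_zero fun ν _ => ?_
      simp only [smul_comm (eta _) Complex.I]
      rw [← Finset.smul_sum, key, smul_zero]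
  comm a b := by
    obtain ⟨φ, I⟩ := b
    cases φ with
    | h μ ν =>
      have e : ∀ (α β : Fin 4), gen a * gen ⟨.u α, β ::ₘ I⟩ =
          sgn a.comp.odd true • (gen ⟨.u α, β ::ₘ I⟩ * gen a) := fun α β => gen_comm _ _
      simp only [gaugeGen, Component.odd, Bool.true_xor, Bool.not_false, mul_smul_comm,
        smul_mul_assoc, mul_add, mul_sub, add_mul, sub_mul, Finset.mul_sum, Finset.sum_mul, e]
      simp only [← Finset.smul_sum]
      module
    | u μ => simp [gaugeGen]
    | ut μ =>
      have e : ∀ (α β : Fin 4), gen a * gen ⟨.h α β, β ::ₘ I⟩ =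
          sgn a.comp.odd false • (gen ⟨.h α β, β ::ₘ I⟩ * gen a) := fun α β => gen_comm _ _
      simp only [gaugeGen, Component.odd, Bool.true_xor, Bool.not_true, mul_smul_comm,
        smul_mul_assoc, Finset.mul_sum, Finset.sum_mul, e]
      simp only [← Finset.smul_sum]
      module

/-- The gauge variation `d_Q`, with `d_Q (A B) = (d_Q A) B + (-1)^{n_g(A)} A (d_Q B)`. -/
def dQ : Wick →ₗ[ℂ] Wick := gradedDerivation true gaugeGen gaugeGen_admissible

/-! ### Divergences, gauge invariance, physical equivalence -/

/-- The divergence `∂_μ W^μ`. -/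
def divergence (W : Fin 4 → Wick) : Wick := ∑ μ : Fin 4, pd μ (W μ)

/-- First order gauge invariance: `d_Q T = i ∂_μ W^μ` for some Wick polynomials `W^μ`. -/
def IsGaugeInvariant (T : Wick) : Prop :=
  ∃ W : Fin 4 → Wick, dQ T = Complex.I • divergence W

/-- Wick polynomials of ghost number `n`. -/
def ghostNumber (n : ℤ) : Submodule ℂ Wick :=
  Submodule.span ℂ
    {F | ∃ l : List Jet, (l.map fun a => a.comp.ghost).sum = n ∧ F = (l.map gen).prod}

/-- Physical equivalence to first order: the couplings differ by a coboundary `d_Q X`, where `X`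
has ghost number `-1`, and a divergence. -/
def PhysicallyEquivalent (T T' : Wick) : Prop :=
  ∃ X ∈ ghostNumber (-1), ∃ W : Fin 4 → Wick, T - T' = dQ X + divergence W

/-- Linear combinations of Wick monomials with field content `ũhh` or `uũũ` and exactly one
derivative. -/
def potentials : Submodule ℂ Wick :=
  Submodule.span ℂ
    {F | ∃ (φ₁ φ₂ φ₃ : Component) (I₁ I₂ I₃ : Multiset (Fin 4)),
      ((∃ α μ ν ρ σ, φ₁ = .ut α ∧ φ₂ = .h μ ν ∧ φ₃ = .h ρ σ) ∨
        (∃ α μ ν, φ₁ = .u α ∧ φ₂ = .ut μ ∧ φ₃ = .ut ν)) ∧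
      I₁.card + I₂.card + I₃.card = 1 ∧
      F = gen ⟨φ₁, I₁⟩ * gen ⟨φ₂, I₂⟩ * gen ⟨φ₃, I₃⟩}

/-! ### The trilinear couplings -/

/-- `h^{μν}_{,I}` -/
def h (μ ν : Fin 4) (I : Multiset (Fin 4)) : Wick := gen ⟨.h μ ν, I⟩

/-- The trace `h_{,I} = η_{μν} h^{μν}_{,I}` -/
def tr (I : Multiset (Fin 4)) : Wick := ∑ μ : Fin 4, eta μ • h μ μ I

/-- `u^μ_{,I}` -/
def u (μ : Fin 4) (I : Multiset (Fin 4)) : Wick := gen ⟨.u μ, I⟩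

/-- `ũ^μ_{,I}` -/
def ut (μ : Fin 4) (I : Multiset (Fin 4)) : Wick := gen ⟨.ut μ, I⟩

/-- The `12 + 21` Wick monomials of the ansatz for the coupling of three tensor fields and for the
ghost coupling. An index that occurs as an upper index and as an index of differentiation is
simply summed over; an index that occurs twice as an upper index is contracted with `η`. -/
def monomial : Fin 33 → Wick := ![
  ∑ μ, ∑ ν, h μ ν {μ} * tr {ν} * tr 0,
  ∑ μ, ∑ ν, h μ ν 0 * tr {μ} * tr {ν},
  ∑ α, ∑ β, ∑ μ, eta β • (h α β {α} * h β μ {μ} * tr 0),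
  ∑ α, ∑ β, ∑ μ, eta β • (h α β {α} * h β μ 0 * tr {μ}),
  ∑ α, ∑ β, ∑ μ, eta β • (h α β 0 * h β μ {α} * tr {μ}),
  ∑ α, ∑ β, ∑ μ, eta β • (h α β {μ} * h β μ {α} * tr 0),
  ∑ μ, ∑ ν, ∑ α, ∑ β, (eta α * eta β) • (h μ ν {μ} * h α β {ν} * h α β 0),
  ∑ μ, ∑ ν, ∑ α, ∑ β, (eta α * eta β) • (h μ ν 0 * h α β {μ} * h α β {ν}),
  ∑ μ, ∑ ν, ∑ α, ∑ β, (eta μ * eta ν) • (h μ ν {α} * h ν α {β} * h μ β 0),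
  ∑ μ, ∑ ν, ∑ α, ∑ β, (eta μ * eta ν) • (h μ ν {α} * h ν α 0 * h μ β {β}),
  ∑ μ, ∑ ν, ∑ α, ∑ β, (eta μ * eta ν) • (h μ ν 0 * h ν α {α} * h μ β {β}),
  ∑ μ, ∑ ν, ∑ α, ∑ β, (eta μ * eta ν) • (h μ ν 0 * h ν α {β} * h μ β {α}),
  ∑ ρ, ∑ μ, ∑ ν, eta μ • (u ρ {ν} * ut μ {ρ} * h μ ν 0),
  ∑ ρ, ∑ μ, ∑ ν, eta μ • (u ρ {ν} * ut μ 0 * h μ ν {ρ}),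
  ∑ ρ, ∑ μ, ∑ ν, eta μ • (u ρ 0 * ut μ {ν} * h μ ν {ρ}),
  ∑ ρ, ∑ μ, ∑ ν, eta μ • (u ρ {ρ} * ut μ {ν} * h μ ν 0),
  ∑ ρ, ∑ μ, ∑ ν, eta μ • (u ρ {ρ} * ut μ 0 * h μ ν {ν}),
  ∑ ρ, ∑ μ, ∑ ν, eta μ • (u ρ 0 * ut μ {ρ} * h μ ν {ν}),
  ∑ ρ, ∑ μ, u ρ {μ} * ut μ {ρ} * tr 0,
  ∑ ρ, ∑ μ, u ρ {μ} * ut μ 0 * tr {ρ},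
  ∑ ρ, ∑ μ, u ρ 0 * ut μ {μ} * tr {ρ},
  ∑ ρ, ∑ μ, u ρ {ρ} * ut μ {μ} * tr 0,
  ∑ ρ, ∑ μ, u ρ {ρ} * ut μ 0 * tr {μ},
  ∑ ρ, ∑ μ, u ρ 0 * ut μ {ρ} * tr {μ},
  ∑ ρ, ∑ μ, ∑ ν, eta ρ • (u ρ {μ} * ut μ {ν} * h ρ ν 0),
  ∑ ρ, ∑ μ, ∑ ν, eta ρ • (u ρ {μ} * ut μ 0 * h ρ ν {ν}),
  ∑ ρ, ∑ μ, ∑ ν, eta ρ • (u ρ 0 * ut μ {μ} * h ρ ν {ν}),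
  ∑ ρ, ∑ μ, ∑ ν, eta ρ • (u ρ {ν} * ut μ {μ} * h ρ ν 0),
  ∑ ρ, ∑ μ, ∑ ν, eta ρ • (u ρ {ν} * ut μ 0 * h ρ ν {μ}),
  ∑ ρ, ∑ μ, ∑ ν, eta ρ • (u ρ 0 * ut μ {ν} * h ρ ν {μ}),
  ∑ ρ, ∑ μ, ∑ ν, eta μ • (u μ {ν} * ut μ {ρ} * h ρ ν 0),
  ∑ ρ, ∑ μ, ∑ ν, eta μ • (u μ {ν} * ut μ 0 * h ρ ν {ρ}),
  ∑ ρ, ∑ μ, ∑ ν, eta μ • (u μ 0 * ut μ {ν} * h ρ ν {ρ})]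

/-- The coupling `T₁` with the parameters `c = (a₁, …, a₁₂, b₁, …, b₂₁)`. -/
def coupling (c : Fin 33 → ℝ) : Wick := ∑ i, (c i : ℂ) • monomial i

theorem coupling_add (c d : Fin 33 → ℝ) : coupling (c + d) = coupling c + coupling d := by
  simp only [coupling, Pi.add_apply, Complex.ofReal_add, add_smul, Finset.sum_add_distrib]

theorem coupling_smul (r : ℝ) (c : Fin 33 → ℝ) : coupling (r • c) = (r : ℂ) • coupling c := by
  simp only [coupling, Pi.smul_apply, smul_eq_mul, Complex.ofReal_mul, mul_smul, Finset.smul_sum]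

/-- The space `V` of parameters of the couplings that are gauge invariant to first order. -/
def V : Submodule ℝ (Fin 33 → ℝ) where
  carrier := {c | IsGaugeInvariant (coupling c)}
  zero_mem' := ⟨0, by simp [divergence, coupling]⟩
  add_mem' := by
    rintro c d ⟨W, hW⟩ ⟨W', hW'⟩
    refine ⟨W + W', ?_⟩
    rw [coupling_add, map_add, hW, hW', ← smul_add]
    simp [divergence, Finset.sum_add_distrib]
  smul_mem' := by
    rintro r c ⟨W, hW⟩
    refine ⟨(r : ℂ) • W, ?_⟩
    rw [coupling_smul, map_smul, hW, smul_comm]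
    simp only [divergence, Pi.smul_apply, map_smul, Finset.smul_sum]

/-- The trilinear Einstein-Hilbert coupling plus the Kugo-Ojima ghost coupling, with coupling
constant `κ`. -/
def einsteinHilbert (κ : ℝ) : Wick :=
  (κ : ℂ) • (
    -(1 / 4 : ℂ) • ∑ μ, ∑ ν, h μ ν 0 * tr {μ} * tr {ν}
    + (1 / 2 : ℂ) • ∑ μ, ∑ ν, ∑ α, ∑ β, (eta α * eta β) • (h μ ν 0 * h α β {μ} * h α β {ν})
    + ∑ μ, ∑ ν, ∑ α, ∑ β, (eta μ * eta ν) • (h μ ν 0 * h ν α {β} * h μ β {α}))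
  + (κ : ℂ) • (
    ∑ ρ, ∑ μ, ∑ ν, eta μ • (u ρ {ν} * ut μ {ρ} * h μ ν 0)
    - ∑ ρ, ∑ μ, ∑ ν, eta μ • (u ρ 0 * ut μ {ν} * h μ ν {ρ})
    - ∑ ρ, ∑ μ, ∑ ν, eta μ • (u ρ {ρ} * ut μ {ν} * h μ ν 0)
    + ∑ ρ, ∑ μ, ∑ ν, eta μ • (u μ {ν} * ut μ {ρ} * h ρ ν 0))

/-- The parameters of the Einstein-Hilbert coupling with Kugo-Ojima ghost coupling, `κ = 1`. -/
def vEH : Fin 33 → ℝ :=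
  ![0, -1/4, 0, 0, 0, 0, 0, 1/2, 0, 0, 0, 1,
    1, 0, -1, -1, 0, 0, 0, 0, 0, 0, 0, 0, 0, 0, 0, 0, 0, 0, 1, 0, 0]

/-- The vectors `v₁, …, v₁₇` (twelve parameters `a`, then twenty-one parameters `b`). -/
def v : Fin 17 → Fin 33 → ℝ := ![
  ![0, 0, -1, -1, 1, 1, 0, 0, 0, 0, 0, 0,
    0, 0, 0, 0, 0, 0, 0, 0, 0, 0, 0, 0, 0, 0, 0, 0, 0, 0, 0, 0, 0],
  ![0, 0, 0, 0, 0, 0, 0, 0, 1, -1, -1, 1,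
    0, 0, 0, 0, 0, 0, 0, 0, 0, 0, 0, 0, 0, 0, 0, 0, 0, 0, 0, 0, 0],
  ![0, 0, 0, 0, 0, 0, 0, 0, 0, 0, 0, 0,
    0, 1, 1, 0, 0, 1, 0, 0, 0, 0, 0, 0, 0, 0, 0, 0, 0, 0, 0, 0, 0],
  ![0, 0, 0, 0, 0, 0, 0, 0, 0, 0, 0, 0,
    -1, -1, 0, 1, 1, 0, 0, 0, 0, 0, 0, 0, 0, 0, 0, 0, 0, 0, 0, 0, 0],
  ![0, 0, 0, 0, 0, 0, 0, 0, 0, 0, 0, 0,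
    0, 0, 0, 0, 1, 2, 0, 0, 0, 0, 0, 0, 0, 0, 0, 0, 0, 0, 0, 0, 0],
  ![0, 0, 1, 0, 0, 0, 0, 0, 0, 0, 0, 0,
    0, 0, 0, 0, 1, 0, 0, 0, 0, 0, 0, 0, 0, 0, 0, 0, 0, 0, 0, 0, 0],
  ![0, 0, 0, 0, 0, 0, 0, 0, 0, 0, 0, 0,
    0, 0, 0, 0, 0, 0, 1, 1, 0, -1, -1, 0, 0, 0, 0, 0, 0, 0, 0, 0, 0],
  ![0, 0, 0, 2, 0, 0, 0, 0, 0, 0, 0, 0,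
    -2, -2, 0, 0, 0, 0, 1, 0, 0, -1, 0, 0, 0, 0, 0, 0, 0, 0, 0, 0, 0],
  ![-1, 0, 0, 0, 0, 0, 0, 0, 0, 0, 0, 0,
    0, 0, 0, 0, 0, 0, 0, 0, 0, 1, 0, 0, 0, 0, 0, 0, 0, 0, 0, 0, 0],
  ![0, 0, 0, 0, 0, 0, 0, 0, 0, 0, 0, 0,
    0, 0, 0, 0, 0, 0, 1, 0, -1, -1, 0, 1, 0, 0, 0, 0, 0, 0, 0, 0, 0],
  ![0, 0, -3/2, 0, 0, 0, 0, 0, 1, 1, 1, 1,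
    0, -2, -1, -1, 0, 0, 0, 0, 0, 0, 0, 0, 1, 0, 0, 0, 0, 0, 1, 0, 0],
  ![0, 0, 0, 0, 0, 0, 0, 0, 0, 0, 0, 0,
    0, 0, 0, 0, 0, 0, 0, 0, 0, 0, 0, 0, 0, 1, 1, 0, 0, 0, 0, 0, 1],
  ![0, 0, 0, 0, 0, 0, 0, 0, 0, 0, 0, 0,
    0, 0, 0, 0, 0, 0, 0, 0, 0, 0, 0, 0, 0, 1, 0, 0, 0, 0, 0, -1, 0],
  ![0, 0, 1/2, 0, 0, 0, 0, 0, -1, 1, 0, -1,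
    0, 0, 0, 0, 0, 0, 0, 0, 0, 0, 0, 0, 0, 0, 0, 0, 0, 0, 0, 1, 0],
  ![0, 0, 0, 0, 0, 0, 0, 0, 0, 0, 0, 0,
    0, 0, 0, 0, 0, 0, 0, 0, 0, 0, 0, 0, -1, 0, 1, 1, 0, -1, 0, 0, 0],
  ![-1/2, 0, 0, 0, 0, 0, 1, 0, 0, 0, 0, 0,
    0, 0, 0, 0, 0, 0, 0, 0, 0, 0, 0, 0, 0, 0, 0, 1, 0, 0, 0, 0, 0],
  ![0, 0, 0, 0, 0, 0, 0, 0, 0, 0, 0, 0,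
    0, 0, 0, 0, 0, 0, 0, 0, 0, 0, 0, 0, 0, 0, 1, 0, -1, -1, 0, 1, 0]]

end SpinTwo

end

/-!
Trilinear Wick polynomials are encoded by *symbols*: polynomials in three momenta `p_j` and three
polarization vectors `w_j`, where `p_j μ` stands for a derivative `∂_μ` of the `j`-th factor and
`w_j μ` for one of its upper indices (`trilin`). In these terms the total momentum
`p_0 + p_1 + p_2` is a total derivative and `p_j²` is a wave operator, so that a symbol in the ideal
generated by these (`kinematic`) gives a divergence (`trilin_mem_divergences`). Since three null
momenta of sum zero are mutually orthogonal, only the contractions `p_1 · w_j`, `p_2 · w_j` and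
`w_i · w_j` are left on shell. The gauge variation becomes a differential operator in the
polarization vectors (`dQ_trilin`), and exchanges of factors permute the slots up to a sign.

With this calculus, `T₁(vᵢ) = d_Q Xᵢ` plus a divergence is a polynomial identity on shell for
explicit symbols of `Xᵢ` (`balance_HHH`, `balance_UTH`). As `d_Q² = 0` (`dQ_dQ`), each `vᵢ` is in
`V`. The gauge variation of a general coupling has a `uhh` part and a `uuũ` part. On shell the
former is a combination of sixteen invariants, whose coefficients are linear forms in the parameters
(`symmetrizeUHH_eq`, `constraint`). For `v_EH` these forms vanish, and so does the `uuũ` part, hence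
`v_EH` is in `V` (`vEH_mem_V`).

Conversely, the conditions given by the `uhh` part are necessary. Inserting plane waves with
nilpotent amplitudes and null momenta of sum zero is an algebra homomorphism on Wick polynomials
(`evalHom`), and its top coefficient vanishes on divergences (`topCoeff_evalHom_divergences`); on
the `uhh` part it evaluates the symmetrized symbol at these momenta and polarizations
(`evalHom_trilin_UHH`), and the `uuũ` part is sent to zero. Enough choices of polarizations show
that all sixteen linear forms vanish on `V` (`constraint_eq_zero`). They have rank `15` on `ℝ³³`, so
that `V` has dimension at most `18` and the eighteen independent vectors found before form a basis
(`sum_coordinates`, `coordinates_sum`). The coordinate of `c` along `v_EH` is the coupling constant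
`κ`.
-/

noncomputable section

namespace SpinTwo

open MvPolynomial Function

/-! ### Leibniz rules on the algebra of Wick polynomials -/

theorem gradedDerivation_gen (p : Bool) (δ : Jet → Wick) (H : Admissible p δ) (a : Jet) :
    gradedDerivation p δ H (gen a) = δ a := by
  have := gradedDerivation_gen_mul p δ H a 1
  rwa [mul_one, mul_one, gradedDerivation_one, mul_zero, smul_zero, add_zero] at this

/-- Induction principle: a property of Wick polynomials that holds for `1`, is linear, and is
stable under left multiplication by field components holds for all Wick polynomials. -/
theorem wick_induction {C : Wick → Prop} (one : C 1) (smul : ∀ (r : ℂ) F, C F → C (r • F))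
    (add : ∀ F G, C F → C G → C (F + G)) (gen_mul : ∀ a F, C F → C (gen a * F)) (F : Wick) :
    C F := by
  have key : ∀ (x : FreeAlgebra ℂ Jet) (G : Wick), C G →
      C (RingQuot.mkAlgHom ℂ FieldRel x * G) := by
    intro x
    induction x using FreeAlgebra.induction with
    | grade0 r =>
      intro G hG
      rw [AlgHom.commutes, ← Algebra.smul_def]
      exact smul r G hG
    | grade1 a => exact fun G hG => gen_mul a G hG
    | mul x y hx hy =>
      intro G hG
      rw [map_mul, mul_assoc]
      exact hx _ (hy _ hG)
    | add x y hx hy =>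
      intro G hG
      rw [map_add, add_mul]
      exact add _ _ (hx _ hG) (hy _ hG)
  obtain ⟨x, rfl⟩ := RingQuot.mkAlgHom_surjective ℂ FieldRel F
  simpa using key x 1 one

theorem pd_gen (μ : Fin 4) (a : Jet) : pd μ (gen a) = gen ⟨a.comp, μ ::ₘ a.derivs⟩ :=
  gradedDerivation_gen _ _ _ a

theorem pd_mul (μ : Fin 4) (F G : Wick) : pd μ (F * G) = pd μ F * G + F * pd μ G := by
  have hg : ∀ a F, pd μ (gen a * F) = pd μ (gen a) * F + gen a * pd μ F := by
    intro a F
    have := gradedDerivation_gen_mul false (partialGen μ) (partialGen_admissible μ) a F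
    rw [pd_gen]
    simpa [pd, sgn, partialGen] using this
  have h1 : pd μ 1 = 0 := gradedDerivation_one _ _ _
  induction F using wick_induction with
  | one => simp [h1]
  | smul r F hF => simp [hF]
  | add F F' hF hF' => simp only [add_mul, map_add, hF, hF']; abel
  | gen_mul a F hF => rw [mul_assoc, hg, hg, hF]; noncomm_ring

theorem dQ_gen (a : Jet) : dQ (gen a) = gaugeGen a := gradedDerivation_gen _ _ _ a

theorem dQ_gen_mul (a : Jet) (F : Wick) :
    dQ (gen a * F) = gaugeGen a * F + sgn true a.comp.odd • (gen a * dQ F) :=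
  gradedDerivation_gen_mul _ _ _ a F

theorem dQ_one : dQ 1 = 0 := gradedDerivation_one _ _ _

theorem gaugeGen_cons (μ : Fin 4) (a : Jet) :
    gaugeGen ⟨a.comp, μ ::ₘ a.derivs⟩ = pd μ (gaugeGen a) := by
  obtain ⟨φ, I⟩ := a
  cases φ with
  | h α β => by_cases hαβ : α = β <;> simp [gaugeGen, pd_gen, Multiset.cons_swap μ, hαβ]
  | u α => simp [gaugeGen]
  | ut α => simp [gaugeGen, pd_gen, Multiset.cons_swap μ]

theorem dQ_pd (μ : Fin 4) (F : Wick) : dQ (pd μ F) = pd μ (dQ F) := by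
  induction F using wick_induction with
  | one => simp [pd, dQ, gradedDerivation_one]
  | smul r F hF => simp [hF]
  | add F G hF hG => simp [hF, hG]
  | gen_mul a F hF =>
    rw [pd_mul, pd_gen, map_add, dQ_gen_mul, dQ_gen_mul, dQ_gen_mul, hF, gaugeGen_cons, map_add,
      map_smul, pd_mul, pd_mul, pd_gen, smul_add]
    abel

/-- The gauge variation of a field component obeys the Leibniz rule of a factor of the opposite
parity. -/
theorem dQ_gaugeGen_mul (a : Jet) (F : Wick) :
    dQ (gaugeGen a * F) = dQ (gaugeGen a) * F - sgn true a.comp.odd • (gaugeGen a * dQ F) := by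
  have key : ∀ b : Jet, b.comp.odd = !a.comp.odd → ∀ F,
      dQ (gen b * F) = dQ (gen b) * F - sgn true a.comp.odd • (gen b * dQ F) := by
    intro b hb F
    have hs : sgn true (!a.comp.odd) = -sgn true a.comp.odd := by
      cases a.comp.odd <;> simp [sgn]
    rw [dQ_gen_mul, dQ_gen, hb, hs]
    module
  obtain ⟨φ, I⟩ := a
  cases φ with
  | h μ ν =>
    have k : ∀ α β, dQ (gen ⟨.u α, β ::ₘ I⟩ * F) = _ := fun α β => key _ rfl F
    simp only [gaugeGen, smul_mul_assoc, sub_mul, add_mul, Finset.sum_mul, map_smul, map_sub,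
      map_add, map_sum, k]
    simp only [Component.odd, sgn, Bool.and_false, Bool.false_eq_true, if_false, one_smul,
      Finset.sum_sub_distrib]
    module
  | u μ => simp [gaugeGen]
  | ut μ =>
    have k : ∀ β, dQ (gen ⟨.h μ β, β ::ₘ I⟩ * F) = _ := fun β => key _ rfl F
    simp only [gaugeGen, smul_mul_assoc, Finset.sum_mul, map_smul, map_sum, k]
    simp only [Component.odd, sgn, Finset.sum_sub_distrib, ← Finset.smul_sum]
    module

theorem eta_mul_self (μ : Fin 4) : eta μ * eta μ = 1 := by
  unfold eta; split <;> norm_num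

theorem dQ_gaugeGen (a : Jet) : dQ (gaugeGen a) = 0 := by
  obtain ⟨φ, I⟩ := a
  cases φ with
  | h μ ν => by_cases hμν : μ = ν <;> simp [gaugeGen, dQ_gen, hμν]
  | u μ => simp [gaugeGen]
  | ut μ =>
    have hw := gen_wave (.u μ) I
    have hs : ∀ α ν, gen ⟨.u α, α ::ₘ ν ::ₘ I⟩ = gen ⟨.u α, ν ::ₘ α ::ₘ I⟩ := fun α ν => by
      rw [Multiset.cons_swap]
    have e : ∑ ν, (if μ = ν then eta μ else 0) • ∑ α, gen ⟨.u α, α ::ₘ ν ::ₘ I⟩ =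
        ∑ ν, eta μ • gen ⟨.u ν, μ ::ₘ ν ::ₘ I⟩ := by
      rw [Finset.sum_eq_single μ (fun ν _ h => by simp [h.symm]) (by simp), if_pos rfl,
        Finset.smul_sum]
      exact Finset.sum_congr rfl fun α _ => by rw [hs]
    simp only [gaugeGen, map_smul, map_sum, dQ_gen]
    rw [← Finset.smul_sum, Finset.sum_sub_distrib, Finset.sum_add_distrib, e, hw]
    simp

/-- The gauge variation is nilpotent. -/
theorem dQ_dQ (F : Wick) : dQ (dQ F) = 0 := by
  induction F using wick_induction with
  | one => simp [dQ_one]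
  | smul r F hF => simp [hF]
  | add F G hF hG => simp [hF, hG]
  | gen_mul a F hF =>
    rw [dQ_gen_mul, map_add, dQ_gaugeGen_mul, map_smul, dQ_gen_mul, hF, dQ_gaugeGen]
    simp

/-! ### Divergences -/

/-- The space of all divergences `∂_μ W^μ`. -/
def divergences : Submodule ℂ Wick where
  carrier := Set.range divergence
  zero_mem' := ⟨0, by simp [divergence]⟩
  add_mem' := by
    rintro _ _ ⟨W, rfl⟩ ⟨W', rfl⟩
    exact ⟨W + W', by simp [divergence, Finset.sum_add_distrib]⟩
  smul_mem' := by
    rintro r _ ⟨W, rfl⟩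
    exact ⟨r • W, by simp [divergence, Finset.smul_sum]⟩

theorem pd_mem_divergences (μ : Fin 4) (F : Wick) : pd μ F ∈ divergences :=
  ⟨Pi.single μ F, by
    rw [divergence, Finset.sum_eq_single μ (fun ν _ hν => by simp [hν]) (by simp)]
    simp⟩

theorem isGaugeInvariant_iff (T : Wick) : IsGaugeInvariant T ↔ dQ T ∈ divergences := by
  constructor
  · rintro ⟨W, hW⟩
    exact hW ▸ divergences.smul_mem _ ⟨W, rfl⟩
  · rintro ⟨W, hW⟩
    refine ⟨(-Complex.I) • W, ?_⟩
    rw [← hW]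
    simp [divergence, Finset.smul_sum, smul_smul]

/-- Coboundaries plus divergences are gauge invariant. -/
theorem isGaugeInvariant_of_eq {T X : Wick} (hT : T - dQ X ∈ divergences) :
    IsGaugeInvariant T := by
  obtain ⟨W, hW⟩ := hT
  rw [isGaugeInvariant_iff, ← sub_add_cancel T (dQ X), ← hW, map_add, dQ_dQ, add_zero]
  exact ⟨fun μ => dQ (W μ), by simp [divergence, dQ_pd]⟩

/-! ### Symbols -/

/-- The three kinds of fields: `H` for `h`, `U` for `u` and `T` for `ũ`. -/
inductive Kind : Type
  | H | U | T
  deriving DecidableEq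

/-- Variables of the symbols of trilinear products: `inl (j, μ)` is the component `p_j μ` of the
momentum, and `inr (j, μ)` the component `w_j μ` of the polarization vector of slot `j`. -/
abbrev Var := (Fin 3 × Fin 4) ⊕ (Fin 3 × Fin 4)

/-- The polynomials in the momenta and polarization vectors of three slots. -/
abbrev Symbols := MvPolynomial Var ℂ

/-- The momentum component `p_j μ`, which stands for `∂_μ` acting on the `j`-th factor. -/
def P (j : Fin 3) (μ : Fin 4) : Symbols := X (.inl (j, μ))

/-- The polarization component `w_j μ`, which stands for an upper index `μ` of the `j`-th factor. -/
def W (j : Fin 3) (μ : Fin 4) : Symbols := X (.inr (j, μ))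

/-- The field indices of slot `j` in a monomial. -/
def pol (m : Var →₀ ℕ) (j : Fin 3) : Multiset (Fin 4) := ∑ μ, m (.inr (j, μ)) • {μ}

/-- The derivative indices of slot `j` in a monomial. -/
def mom (m : Var →₀ ℕ) (j : Fin 3) : Multiset (Fin 4) := ∑ μ, m (.inl (j, μ)) • {μ}

/-- The exponent of the monomial with field indices `s` and derivative indices `I`. -/
def expo (s I : Fin 3 → Multiset (Fin 4)) : Var →₀ ℕ :=
  Finsupp.equivFunOnFinite.symm
    (Sum.elim (fun i => (I i.1).count i.2) (fun i => (s i.1).count i.2))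

theorem pol_expo (s I) : pol (expo s I) = s := by
  funext j
  ext ν
  simp [pol, expo, Multiset.count_sum', Multiset.count_singleton]

theorem mom_expo (s I) : mom (expo s I) = I := by
  funext j
  ext ν
  simp [mom, expo, Multiset.count_sum', Multiset.count_singleton]

theorem expo_pol_mom (m : Var →₀ ℕ) : expo (pol m) (mom m) = m := by
  ext i
  rcases i with ⟨j, μ⟩ | ⟨j, μ⟩ <;>
  simp [pol, mom, expo, Multiset.count_sum', Multiset.count_singleton]

/-- The monomial `∏_j ∏_{μ ∈ s j} w_j μ ∏_{ν ∈ I j} p_j ν`. -/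
def slots (s I : Fin 3 → Multiset (Fin 4)) : Symbols := MvPolynomial.monomial (expo s I) 1

@[simp] theorem expo_inl (s I : Fin 3 → Multiset (Fin 4)) (i : Fin 3 × Fin 4) :
    expo s I (.inl i) = (I i.1).count i.2 := rfl

@[simp] theorem expo_inr (s I : Fin 3 → Multiset (Fin 4)) (i : Fin 3 × Fin 4) :
    expo s I (.inr i) = (s i.1).count i.2 := rfl

theorem count_update_cons (s : Fin 3 → Multiset (Fin 4)) (j k : Fin 3) (μ ν : Fin 4) :
    (update s j (μ ::ₘ s j) k).count ν = (if (j, μ) = (k, ν) then 1 else 0) + (s k).count ν := by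
  rcases eq_or_ne j k with rfl | hk
  · simp [Multiset.count_cons, add_comm, eq_comm]
  · simp [hk, hk.symm]

theorem P_mul_slots (j μ) (s I : Fin 3 → Multiset (Fin 4)) :
    P j μ * slots s I = slots s (update I j (μ ::ₘ I j)) := by
  rw [P, X, slots, monomial_mul, one_mul, slots]
  refine congrArg (MvPolynomial.monomial · 1) (Finsupp.ext fun i => ?_)
  rcases i with ⟨k, ν⟩ | ⟨k, ν⟩ <;>
    simp [count_update_cons, Finsupp.single_apply]

theorem W_mul_slots (j μ) (s I : Fin 3 → Multiset (Fin 4)) :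
    W j μ * slots s I = slots (update s j (μ ::ₘ s j)) I := by
  rw [W, X, slots, monomial_mul, one_mul, slots]
  refine congrArg (MvPolynomial.monomial · 1) (Finsupp.ext fun i => ?_)
  rcases i with ⟨k, ν⟩ | ⟨k, ν⟩ <;>
    simp [count_update_cons, Finsupp.single_apply]

theorem slots_zero : slots 0 0 = 1 := by
  have : expo 0 0 = 0 := Finsupp.ext fun i => by rcases i with i | i <;> simp
  rw [slots, this]
  rfl

/-- Linear maps on symbols are determined by their values on monomials. -/
theorem symbols_ext {M : Type*} [AddCommMonoid M] [Module ℂ M] {f g : Symbols →ₗ[ℂ] M}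
    (hfg : ∀ s I, f (slots s I) = g (slots s I)) : f = g := by
  refine (basisMonomials Var ℂ).ext fun m => ?_
  have := hfg (pol m) (mom m)
  rwa [slots, expo_pol_mom] at this

theorem pderiv_slots (j ν) (s I : Fin 3 → Multiset (Fin 4)) :
    pderiv (.inr (j, ν)) (slots s I) =
      ((s j).count ν : ℂ) • slots (update s j ((s j).erase ν)) I := by
  rw [slots, pderiv_monomial, slots, smul_monomial, expo_inr, one_mul, smul_eq_mul, mul_one]
  refine congrArg (MvPolynomial.monomial · _) (Finsupp.ext fun i => ?_)
  rcases i with ⟨k, κ⟩ | ⟨k, κ⟩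
  · simp
  · rcases eq_or_ne j k with rfl | hk
    · rcases eq_or_ne ν κ with rfl | hν
      · simp
      · simp [hν.symm]
    · simp [hk.symm]

/-! ### Normal products from symbols -/

namespace Kind

/-- Parity of a kind of field: `true` for Fermi fields. -/
def odd : Kind → Bool
  | H => false
  | U => true
  | T => true

/-- Ghost number of a kind of field -/
def ghost : Kind → ℤ
  | H => 0
  | U => 1
  | T => -1

end Kind

/-- The field of the given kind with field indices `s` and derivative indices `I`. It is zero unless
`s` has the number of elements that the kind requires. The components of `h` are listed with
`μ ≤ ν`, so that each unordered pair of indices counts once. -/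
def fld : Kind → Multiset (Fin 4) → Multiset (Fin 4) → Wick
  | .H, s, I => ∑ μ, ∑ ν, if μ ≤ ν ∧ s = {μ, ν} then gen ⟨.h μ ν, I⟩ else 0
  | .U, s, I => ∑ μ, if s = {μ} then gen ⟨.u μ, I⟩ else 0
  | .T, s, I => ∑ μ, if s = {μ} then gen ⟨.ut μ, I⟩ else 0

theorem fld_U (μ : Fin 4) (I : Multiset (Fin 4)) : fld .U {μ} I = u μ I := by
  simp [fld, u]

theorem fld_T (μ : Fin 4) (I : Multiset (Fin 4)) : fld .T {μ} I = ut μ I := by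
  simp [fld, ut]

theorem fld_H (μ ν : Fin 4) (I : Multiset (Fin 4)) : fld .H {μ, ν} I = h μ ν I := by
  have key : ∀ μ ν : Fin 4, μ ≤ ν → fld .H {μ, ν} I = h μ ν I := by
    intro μ ν hμν
    have hp : ∀ α β : Fin 4, (α ≤ β ∧ ({μ, ν} : Multiset (Fin 4)) = {α, β}) ↔ α = μ ∧ β = ν := by
      revert μ ν; decide
    simp only [fld, hp, ite_and]
    simp [h]
  rcases le_total μ ν with hμν | hμν
  · exact key μ ν hμν
  · rw [Multiset.pair_comm, key ν μ hμν]
    exact gen_symm ν μ I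

theorem fld_U_of_card {s : Multiset (Fin 4)} (hs : s.card ≠ 1) (I : Multiset (Fin 4)) :
    fld .U s I = 0 :=
  Finset.sum_eq_zero fun μ _ => if_neg fun e => hs (by simp [e])

theorem fld_T_of_card {s : Multiset (Fin 4)} (hs : s.card ≠ 1) (I : Multiset (Fin 4)) :
    fld .T s I = 0 :=
  Finset.sum_eq_zero fun μ _ => if_neg fun e => hs (by simp [e])

theorem fld_H_of_card {s : Multiset (Fin 4)} (hs : s.card ≠ 2) (I : Multiset (Fin 4)) :
    fld .H s I = 0 :=
  Finset.sum_eq_zero fun μ _ => Finset.sum_eq_zero fun ν _ => if_neg fun e => hs (by simp [e])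

/-- A field with given indices is zero or a generator of the algebra of Wick polynomials. -/
theorem fld_cases (k : Kind) (s : Multiset (Fin 4)) :
    (∀ I, fld k s I = 0) ∨ ∃ φ : Component, φ.odd = k.odd ∧ φ.ghost = k.ghost ∧
      ∀ I, fld k s I = gen ⟨φ, I⟩ := by
  cases k with
  | H =>
    by_cases hs : s.card = 2
    · obtain ⟨μ, ν, rfl⟩ := Multiset.card_eq_two.1 hs
      exact .inr ⟨.h μ ν, rfl, rfl, fun I => fld_H μ ν I⟩
    · exact .inl (fld_H_of_card hs)
  | U =>
    by_cases hs : s.card = 1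
    · obtain ⟨μ, rfl⟩ := Multiset.card_eq_one.1 hs
      exact .inr ⟨.u μ, rfl, rfl, fun I => fld_U μ I⟩
    · exact .inl (fld_U_of_card hs)
  | T =>
    by_cases hs : s.card = 1
    · obtain ⟨μ, rfl⟩ := Multiset.card_eq_one.1 hs
      exact .inr ⟨.ut μ, rfl, rfl, fun I => fld_T μ I⟩
    · exact .inl (fld_T_of_card hs)

theorem pd_fld (μ : Fin 4) (k : Kind) (s I : Multiset (Fin 4)) :
    pd μ (fld k s I) = fld k s (μ ::ₘ I) := by
  rcases fld_cases k s with hs | ⟨φ, -, -, hs⟩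
  · simp [hs]
  · rw [hs, hs, pd_gen]

theorem wave_fld (k : Kind) (s I : Multiset (Fin 4)) :
    ∑ μ, eta μ • fld k s (μ ::ₘ μ ::ₘ I) = 0 := by
  rcases fld_cases k s with hs | ⟨φ, -, -, hs⟩
  · simp [hs]
  · simp only [hs, gen_wave]

theorem fld_comm (k k' : Kind) (s I s' I' : Multiset (Fin 4)) :
    fld k s I * fld k' s' I' = sgn k.odd k'.odd • (fld k' s' I' * fld k s I) := by
  rcases fld_cases k s with hs | ⟨φ, ho, -, hs⟩
  · simp [hs]
  rcases fld_cases k' s' with hs' | ⟨φ', ho', -, hs'⟩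
  · simp [hs']
  rw [hs, hs', gen_comm, ho, ho']

theorem dQ_fld_mul (k : Kind) (s I : Multiset (Fin 4)) (F : Wick) :
    dQ (fld k s I * F) = dQ (fld k s I) * F + sgn true k.odd • (fld k s I * dQ F) := by
  rcases fld_cases k s with hs | ⟨φ, ho, -, hs⟩
  · simp [hs]
  · rw [hs, dQ_gen_mul, dQ_gen, ho]

/-- The product of three Wick polynomials as a multilinear map. -/
def tri : MultilinearMap ℂ (fun _ : Fin 3 => Wick) Wick := MultilinearMap.mkPiAlgebraFin ℂ 3 Wick

theorem tri_apply (x : Fin 3 → Wick) : tri x = x 0 * x 1 * x 2 := by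
  simp [tri, MultilinearMap.mkPiAlgebraFin_apply, List.ofFn_succ, mul_assoc]

/-- The trilinear Wick polynomial with factors of kinds `K 0`, `K 1`, `K 2` that has the given
symbol: a monomial is sent to the product of the three fields with the indices it lists. Monomials
whose degree in a polarization vector does not fit the kind of the field are sent to zero. -/
def trilin (K : Fin 3 → Kind) : Symbols →ₗ[ℂ] Wick :=
  (basisMonomials Var ℂ).constr ℂ fun m => tri fun j => fld (K j) (pol m j) (mom m j)

theorem trilin_slots (K : Fin 3 → Kind) (s I : Fin 3 → Multiset (Fin 4)) :
    trilin K (slots s I) = tri fun j => fld (K j) (s j) (I j) := by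
  have := (basisMonomials Var ℂ).constr_basis ℂ
    (fun m => tri fun j => fld (K j) (pol m j) (mom m j)) (expo s I)
  rwa [coe_basisMonomials, pol_expo, mom_expo] at this

theorem fld_update_mom (K : Fin 3 → Kind) (s I : Fin 3 → Multiset (Fin 4)) (j : Fin 3)
    (J : Multiset (Fin 4)) :
    (fun k => fld (K k) (s k) (update I j J k)) =
      update (fun k => fld (K k) (s k) (I k)) j (fld (K j) (s j) J) := by
  funext k
  rcases eq_or_ne k j with rfl | hk
  · simp
  · simp [hk]

theorem fld_update (K : Fin 3 → Kind) (s I : Fin 3 → Multiset (Fin 4)) (j : Fin 3)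
    (k' : Kind) (t J : Multiset (Fin 4)) :
    (fun k => fld (update K j k' k) (update s j t k) (update I j J k)) =
      update (fun k => fld (K k) (s k) (I k)) j (fld k' t J) := by
  funext k
  rcases eq_or_ne k j with rfl | hk
  · simp
  · simp [hk]

/-! ### Momentum conservation and the wave equation -/

/-- Multiplication of the symbol by the total momentum is the derivative of the product. -/
theorem trilin_sum_P_mul (K : Fin 3 → Kind) (μ : Fin 4) (f : Symbols) :
    trilin K ((∑ j, P j μ) * f) = pd μ (trilin K f) := by
  have : trilin K ∘ₗ LinearMap.mulLeft ℂ (∑ j, P j μ) = pd μ ∘ₗ trilin K := by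
    refine symbols_ext fun s I => ?_
    simp only [LinearMap.comp_apply, LinearMap.mulLeft_apply, Finset.sum_mul, map_sum,
      P_mul_slots, trilin_slots, fld_update_mom, ← pd_fld]
    simp [Fin.sum_univ_three, tri_apply, pd_mul, mul_add, mul_assoc, add_assoc]
  exact LinearMap.congr_fun this f

/-- The contraction `p_i · p_j` of two momenta. -/
def pp (i j : Fin 3) : Symbols := ∑ μ, C (eta μ) * P i μ * P j μ

/-- The contraction `p_i · w_j`: a derivative of factor `i` with an upper index of factor `j`. -/
def pw (i j : Fin 3) : Symbols := ∑ μ, P i μ * W j μ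

/-- The contraction `w_i · w_j` of upper indices of factors `i` and `j`; for `i = j` a trace. -/
def ww (i j : Fin 3) : Symbols := ∑ μ, C (eta μ) * W i μ * W j μ

/-- The wave equation in terms of symbols. -/
theorem trilin_pp_mul (K : Fin 3 → Kind) (j : Fin 3) (f : Symbols) :
    trilin K (pp j j * f) = 0 := by
  have : trilin K ∘ₗ LinearMap.mulLeft ℂ (pp j j) = 0 := by
    refine symbols_ext fun s I => ?_
    simp only [LinearMap.comp_apply, LinearMap.mulLeft_apply, pp, Finset.sum_mul, map_sum,
      mul_assoc, P_mul_slots, C_mul', smul_mul_assoc, map_smul, trilin_slots, fld_update_mom,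
      update_idem, update_self, LinearMap.zero_apply]
    have e := tri.map_update_sum Finset.univ j
      (fun μ => eta μ • fld (K j) (s j) (μ ::ₘ μ ::ₘ I j)) (fun k => fld (K k) (s k) (I k))
    simpa only [wave_fld, MultilinearMap.map_update_zero, MultilinearMap.map_update_smul]
      using e.symm
  exact LinearMap.congr_fun this f

/-- The ideal generated by `p_0 + p_1 + p_2` and by the squares of the momenta. -/
def kinematic : Ideal Symbols :=
  Ideal.span (Set.range (fun μ => ∑ j, P j μ) ∪ Set.range fun j => pp j j)

/-- Symbols that vanish by momentum conservation and the mass shell condition give divergences. -/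
theorem trilin_mem_divergences (K : Fin 3 → Kind) {f : Symbols} (hf : f ∈ kinematic) :
    trilin K f ∈ divergences := by
  suffices ∀ g, trilin K (g * f) ∈ divergences by simpa using this 1
  induction hf using Submodule.span_induction with
  | mem x hx =>
    intro g
    rw [mul_comm]
    rcases hx with ⟨μ, rfl⟩ | ⟨j, rfl⟩
    · rw [trilin_sum_P_mul]
      exact pd_mem_divergences _ _
    · rw [trilin_pp_mul]
      exact divergences.zero_mem
  | zero => simp
  | add x y _ _ hx hy => exact fun g => by rw [mul_add, map_add]; exact add_mem (hx g) (hy g)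
  | smul a x _ hx => exact fun g => by rw [smul_eq_mul, ← mul_assoc]; exact hx (g * a)

/-! ### Exchange of slots -/

/-- Renaming of the slots. -/
def perm (e : Fin 3 → Fin 3) : Symbols →ₐ[ℂ] Symbols :=
  rename (Sum.map (Prod.map e id) (Prod.map e id))

@[simp] theorem perm_pw (e : Fin 3 → Fin 3) (i j : Fin 3) : perm e (pw i j) = pw (e i) (e j) := by
  simp [perm, pw, P, W]

@[simp] theorem perm_ww (e : Fin 3 → Fin 3) (i j : Fin 3) : perm e (ww i j) = ww (e i) (e j) := by
  simp [perm, ww, W]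

@[simp] theorem perm_pp (e : Fin 3 → Fin 3) (i j : Fin 3) : perm e (pp i j) = pp (e i) (e j) := by
  simp [perm, pp, P]

theorem perm_slots (e : Equiv.Perm (Fin 3)) (s I : Fin 3 → Multiset (Fin 4)) :
    perm e (slots s I) = slots (s ∘ e.symm) (I ∘ e.symm) := by
  rw [perm, slots, rename_monomial, slots]
  refine congrArg (MvPolynomial.monomial · 1) (Finsupp.ext fun i => ?_)
  have hi : Injective (Sum.map (Prod.map e id) (Prod.map e id) : Var → Var) :=
    (e.injective.prodMap injective_id).sumMap (e.injective.prodMap injective_id)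
  rcases i with ⟨k, ν⟩ | ⟨k, ν⟩
  · have := Finsupp.mapDomain_apply hi (expo s I) (.inl (e.symm k, ν))
    simpa using this
  · have := Finsupp.mapDomain_apply hi (expo s I) (.inr (e.symm k, ν))
    simpa using this

/-- The exchange of slots `0` and `1`. -/
def s01 : Equiv.Perm (Fin 3) := Equiv.swap 0 1

/-- The exchange of slots `1` and `2`. -/
def s12 : Equiv.Perm (Fin 3) := Equiv.swap 1 2

theorem trilin_perm_s01 (K : Fin 3 → Kind) (f : Symbols) :
    trilin K (perm s01 f) = sgn (K 0).odd (K 1).odd • trilin (K ∘ s01) f := by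
  have : trilin K ∘ₗ (perm s01).toLinearMap = sgn (K 0).odd (K 1).odd • trilin (K ∘ s01) := by
    refine symbols_ext fun s I => ?_
    have es : s01.symm = s01 := Equiv.symm_swap _ _
    have e0 : s01 0 = 1 := by decide
    have e1 : s01 1 = 0 := by decide
    have e2 : s01 2 = 2 := by decide
    simp only [LinearMap.comp_apply, AlgHom.toLinearMap_apply, perm_slots, trilin_slots,
      LinearMap.smul_apply, tri_apply, comp_apply, es, e0, e1, e2]
    rw [fld_comm, smul_mul_assoc]
  exact LinearMap.congr_fun this f

theorem trilin_perm_s12 (K : Fin 3 → Kind) (f : Symbols) :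
    trilin K (perm s12 f) = sgn (K 1).odd (K 2).odd • trilin (K ∘ s12) f := by
  have : trilin K ∘ₗ (perm s12).toLinearMap = sgn (K 1).odd (K 2).odd • trilin (K ∘ s12) := by
    refine symbols_ext fun s I => ?_
    have es : s12.symm = s12 := Equiv.symm_swap _ _
    have e0 : s12 0 = 0 := by decide
    have e1 : s12 1 = 2 := by decide
    have e2 : s12 2 = 1 := by decide
    simp only [LinearMap.comp_apply, AlgHom.toLinearMap_apply, perm_slots, trilin_slots,
      LinearMap.smul_apply, tri_apply, comp_apply, es, e0, e1, e2]
    rw [mul_assoc, fld_comm, mul_smul_comm, mul_assoc]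
  exact LinearMap.congr_fun this f

/-! ### Gauge variation of symbols -/

/-- The kind of the fields in the gauge variation of a field. As `d_Q u = 0`, the value at `U` is
arbitrary. -/
def Kind.next : Kind → Kind
  | H => U
  | U => U
  | T => H

/-- The derivative of symbols along `x` with respect to the polarization vector of slot `j`. -/
def dir (j : Fin 3) (x : Fin 4 → Symbols) : Derivation ℂ Symbols Symbols :=
  ∑ μ, x μ • pderiv (.inr (j, μ))

theorem dir_apply (j : Fin 3) (x : Fin 4 → Symbols) (f : Symbols) :
    dir j x f = ∑ μ, x μ * pderiv (.inr (j, μ)) f := by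
  rw [dir, ← Derivation.coeFnAddMonoidHom_apply, map_sum, Finset.sum_apply]
  rfl

/-- The Laplacian of the metric `η` with respect to the polarization vector of slot `j`. On a symbol
that is quadratic in `w_j` it takes twice the trace. -/
def lap (j : Fin 3) : Symbols →ₗ[ℂ] Symbols :=
  ∑ μ, eta μ • ((pderiv (.inr (j, μ)) : Derivation ℂ Symbols Symbols) : Symbols →ₗ[ℂ] Symbols) ∘ₗ
    ((pderiv (.inr (j, μ)) : Derivation ℂ Symbols Symbols) : Symbols →ₗ[ℂ] Symbols)

/-- The gauge variation of a field of the given kind in slot `j`, up to the factor `i`. As symbols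
of `h` are quadratic in `w_j`, replacing one factor `w_j` by the momentum in all ways is a
directional derivative, and the term `η^{μν} ∂_α u^α` is half of the Laplacian times `p_j · w_j`. -/
def vary (j : Fin 3) : Kind → Symbols →ₗ[ℂ] Symbols
  | .H => (-(1 / 2) : ℂ) • (dir j (fun μ => C (eta μ) * P j μ) : Symbols →ₗ[ℂ] Symbols) +
      (1 / 4 : ℂ) • LinearMap.mulLeft ℂ (pw j j) ∘ₗ lap j
  | .U => 0
  | .T => LinearMap.mulLeft ℂ (pw j j)

theorem dQ_fld_T (s I : Multiset (Fin 4)) :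
    dQ (fld .T s I) = Complex.I • ∑ μ, fld .H (μ ::ₘ s) (μ ::ₘ I) := by
  by_cases hs : s.card = 1
  · obtain ⟨ν, rfl⟩ := Multiset.card_eq_one.1 hs
    have hc : ∀ μ : Fin 4, fld .H (μ ::ₘ {ν}) (μ ::ₘ I) = gen ⟨.h ν μ, μ ::ₘ I⟩ := fun μ =>
      (congrArg (fld .H · _) (Multiset.pair_comm μ ν)).trans (fld_H ν μ _)
    simp only [fld_T, ut, dQ_gen, gaugeGen, hc]
  · rw [fld_T_of_card hs, map_zero, Finset.sum_eq_zero, smul_zero]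
    exact fun μ _ => fld_H_of_card (by simpa using hs) _

theorem dQ_fld_H (s I : Multiset (Fin 4)) :
    dQ (fld .H s I) = Complex.I •
      (-(1 / 2 : ℂ) • ∑ ν, (eta ν * s.count ν) • fld .U (s.erase ν) (ν ::ₘ I) +
        (1 / 4 : ℂ) • ∑ ν, ∑ α, (eta ν * s.count ν * (s.erase ν).count ν) •
          fld .U (α ::ₘ (s.erase ν).erase ν) (α ::ₘ I)) := by
  by_cases hs : s.card = 2
  · obtain ⟨μ, ν, rfl⟩ := Multiset.card_eq_two.1 hs
    rw [fld_H, h, dQ_gen, gaugeGen]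
    rcases eq_or_ne μ ν with rfl | hμν
    · have e1 : ∀ κ, (eta κ * (({μ, μ} : Multiset (Fin 4)).count κ : ℂ)) •
          fld .U (({μ, μ} : Multiset (Fin 4)).erase κ) (κ ::ₘ I) =
          if κ = μ then (2 * eta μ) • gen ⟨.u μ, μ ::ₘ I⟩ else 0 := by
        intro κ
        rcases eq_or_ne κ μ with rfl | hκ
        · rw [if_pos rfl, mul_comm 2]
          simp [fld_U, u]
        · simp [hκ]
      have e2 : ∀ κ α, (eta κ * (({μ, μ} : Multiset (Fin 4)).count κ : ℂ) *
          (((({μ, μ} : Multiset (Fin 4)).erase κ).count κ : ℕ) : ℂ)) •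
          fld .U (α ::ₘ (({μ, μ} : Multiset (Fin 4)).erase κ).erase κ) (α ::ₘ I) =
          if κ = μ then (2 * eta μ) • gen ⟨.u α, α ::ₘ I⟩ else 0 := by
        intro κ α
        rcases eq_or_ne κ μ with rfl | hκ
        · rw [if_pos rfl, mul_comm 2]
          simp [fld_U, u]
        · simp [hκ]
      simp only [e1, e2]
      rw [Finset.sum_comm]
      simp only [Finset.sum_ite_eq', Finset.mem_univ, if_true, ← Finset.smul_sum]
      module
    · have e1 : ∀ κ, (eta κ * (({μ, ν} : Multiset (Fin 4)).count κ : ℂ)) •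
          fld .U (({μ, ν} : Multiset (Fin 4)).erase κ) (κ ::ₘ I) =
          (if κ = μ then eta μ • gen ⟨.u ν, μ ::ₘ I⟩ else 0) +
          if κ = ν then eta ν • gen ⟨.u μ, ν ::ₘ I⟩ else 0 := by
        intro κ
        rcases eq_or_ne κ μ with rfl | hκ
        · simp [fld_U, u, hμν]
        · rcases eq_or_ne κ ν with rfl | hκ'
          · simp [fld_U, u, hκ, hκ.symm]
          · simp [hκ, hκ']
      have e2 : ∀ κ α, (eta κ * (({μ, ν} : Multiset (Fin 4)).count κ : ℂ) *
          (((({μ, ν} : Multiset (Fin 4)).erase κ).count κ : ℕ) : ℂ)) •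
          fld .U (α ::ₘ (({μ, ν} : Multiset (Fin 4)).erase κ).erase κ) (α ::ₘ I) = 0 := by
        intro κ α
        rcases eq_or_ne κ μ with rfl | hκ
        · simp [hμν]
        · rcases eq_or_ne κ ν with rfl | hκ'
          · simp [hκ, hκ.symm]
          · simp [hκ, hκ']
      simp only [e1, e2, if_neg hμν, Finset.sum_add_distrib, Finset.sum_ite_eq', Finset.mem_univ,
        if_true, Finset.sum_const_zero]
      module
  · rw [fld_H_of_card hs, map_zero, Finset.sum_eq_zero, Finset.sum_eq_zero]
    · simp
    · refine fun ν _ => Finset.sum_eq_zero fun α _ => ?_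
      by_cases h1 : ν ∈ s
      · by_cases h2 : ν ∈ s.erase ν
        · rw [fld_U_of_card, smul_zero]
          have := Multiset.card_erase_add_one h1
          have := Multiset.card_erase_add_one h2
          rw [Multiset.card_cons]
          omega
        · simp [Multiset.count_eq_zero.2 h2]
      · simp [Multiset.count_eq_zero.2 h1]
    · intro ν _
      by_cases h1 : ν ∈ s
      · rw [fld_U_of_card, smul_zero]
        have := Multiset.card_erase_add_one h1
        omega
      · simp [Multiset.count_eq_zero.2 h1]

/-- The gauge variation of the `j`-th factor of a monomial, in terms of its symbol. -/
theorem trilin_vary (K : Fin 3 → Kind) (j : Fin 3) (s I : Fin 3 → Multiset (Fin 4)) :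
    Complex.I • trilin (update K j (K j).next) (vary j (K j) (slots s I)) =
      tri (update (fun k => fld (K k) (s k) (I k)) j (dQ (fld (K j) (s j) (I j)))) := by
  cases hK : K j with
  | H =>
    simp only [vary, Kind.next, LinearMap.add_apply, LinearMap.smul_apply, dir_apply, lap,
      Derivation.coeFn_coe, LinearMap.sum_apply, LinearMap.comp_apply, pderiv_slots,
      LinearMap.mulLeft_apply, map_smul, update_self, update_idem, pw, C_mul', Finset.sum_mul,
      mul_assoc, smul_mul_assoc, mul_smul_comm, P_mul_slots, W_mul_slots, map_add, map_sum,
      trilin_slots, fld_update, dQ_fld_H, MultilinearMap.map_update_add,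
      MultilinearMap.map_update_smul, MultilinearMap.map_update_sum, smul_smul, Finset.smul_sum]
    simp only [mul_comm (Nat.cast _ : ℂ) (eta _)]
  | U => simp [vary, fld, dQ_gen, gaugeGen, apply_ite, tri.map_update_zero]
  | T =>
    simp only [vary, Kind.next, LinearMap.mulLeft_apply, pw, Finset.sum_mul, mul_assoc,
      P_mul_slots, W_mul_slots, map_sum, trilin_slots, fld_update, dQ_fld_T,
      MultilinearMap.map_update_smul, MultilinearMap.map_update_sum]

/-- The gauge variation of a trilinear Wick polynomial in terms of its symbol. -/
theorem dQ_trilin (K : Fin 3 → Kind) (f : Symbols) :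
    dQ (trilin K f) = Complex.I • (trilin (update K 0 (K 0).next) (vary 0 (K 0) f) +
      sgn true (K 0).odd • trilin (update K 1 (K 1).next) (vary 1 (K 1) f) +
      (sgn true (K 0).odd * sgn true (K 1).odd) •
        trilin (update K 2 (K 2).next) (vary 2 (K 2) f)) := by
  have : dQ ∘ₗ trilin K = Complex.I • (trilin (update K 0 (K 0).next) ∘ₗ vary 0 (K 0) +
      sgn true (K 0).odd • trilin (update K 1 (K 1).next) ∘ₗ vary 1 (K 1) +
      (sgn true (K 0).odd * sgn true (K 1).odd) •
        trilin (update K 2 (K 2).next) ∘ₗ vary 2 (K 2)) := by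
    refine symbols_ext fun s I => ?_
    simp only [LinearMap.comp_apply, LinearMap.add_apply, LinearMap.smul_apply, smul_add,
      smul_comm Complex.I (sgn _ _), smul_comm Complex.I (sgn _ _ * sgn _ _), trilin_vary]
    rw [trilin_slots, tri_apply, mul_assoc, dQ_fld_mul, dQ_fld_mul]
    simp [tri_apply, mul_add, smul_smul, mul_assoc, add_assoc]
  exact LinearMap.congr_fun this f

/-! ### Symbols of the couplings -/

/-- The field content `hhh`. -/
def HHH : Fin 3 → Kind := ![.H, .H, .H]

/-- The field content `uũh`. -/
def UTH : Fin 3 → Kind := ![.U, .T, .H]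

theorem fld_H_cons (μ ν : Fin 4) (I : Multiset (Fin 4)) : fld .H (μ ::ₘ {ν}) I = h μ ν I :=
  fld_H μ ν I

theorem prod_map_eq (f : Fin 4 → Symbols) (s : Multiset (Fin 4)) :
    (s.map f).prod = ∏ μ, f μ ^ s.count μ := by
  induction s using Multiset.induction with
  | empty => simp
  | cons ν s ih =>
    simp only [Multiset.map_cons, Multiset.prod_cons, ih, Multiset.count_cons, pow_add,
      Finset.prod_mul_distrib, pow_ite, pow_one, pow_zero, Finset.prod_ite_eq', Finset.mem_univ,
      if_true]
    rw [mul_comm]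

theorem slots_eq_prod (s I : Fin 3 → Multiset (Fin 4)) :
    slots s I = ((s 0).map (W 0)).prod * ((I 0).map (P 0)).prod *
      (((s 1).map (W 1)).prod * ((I 1).map (P 1)).prod) *
      (((s 2).map (W 2)).prod * ((I 2).map (P 2)).prod) := by
  rw [slots, monomial_eq, C_1, one_mul, Finsupp.prod_fintype _ _ fun _ => pow_zero _]
  simp only [Fintype.prod_sum_type, Fintype.prod_prod_type, Fin.prod_univ_three, expo_inl,
    expo_inr, prod_map_eq, P, W]
  ring

theorem fld_mul_fld_mul_fld (K : Fin 3 → Kind) (s I : Fin 3 → Multiset (Fin 4)) :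
    fld (K 0) (s 0) (I 0) * fld (K 1) (s 1) (I 1) * fld (K 2) (s 2) (I 2) =
      trilin K (((s 0).map (W 0)).prod * ((I 0).map (P 0)).prod *
      (((s 1).map (W 1)).prod * ((I 1).map (P 1)).prod) *
      (((s 2).map (W 2)).prod * ((I 2).map (P 2)).prod)) := by
  rw [← slots_eq_prod, trilin_slots, tri_apply]

theorem hhh_eq (μ ν α β γ δ : Fin 4) (I J L : Multiset (Fin 4)) :
    h μ ν I * h α β J * h γ δ L = trilin HHH (W 0 μ * W 0 ν * (I.map (P 0)).prod *
      (W 1 α * W 1 β * (J.map (P 1)).prod) * (W 2 γ * W 2 δ * (L.map (P 2)).prod)) := by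
  have := fld_mul_fld_mul_fld HHH ![{μ, ν}, {α, β}, {γ, δ}] ![I, J, L]
  simpa [HHH, fld_H_cons] using this

theorem uth_eq (μ α γ δ : Fin 4) (I J L : Multiset (Fin 4)) :
    u μ I * ut α J * h γ δ L = trilin UTH (W 0 μ * (I.map (P 0)).prod *
      (W 1 α * (J.map (P 1)).prod) * (W 2 γ * W 2 δ * (L.map (P 2)).prod)) := by
  have := fld_mul_fld_mul_fld UTH ![{μ}, {α}, {γ, δ}] ![I, J, L]
  simpa [UTH, fld_H_cons, fld_U, fld_T] using this

set_option maxHeartbeats 1000000 in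
/-- The monomials of the ansatz in terms of symbols; slot `j` belongs to the `j`-th factor. -/
theorem monomial_eq : monomial = ![
    trilin HHH (ww 1 1 * ww 2 2 * pw 1 0 * pw 0 0),
    trilin HHH (ww 1 1 * ww 2 2 * pw 2 0 * pw 1 0),
    trilin HHH (ww 2 2 * pw 1 1 * ww 0 1 * pw 0 0),
    trilin HHH (ww 2 2 * pw 2 1 * ww 0 1 * pw 0 0),
    trilin HHH (ww 2 2 * pw 2 1 * ww 0 1 * pw 1 0),
    trilin HHH (ww 2 2 * pw 0 1 * ww 0 1 * pw 1 0),
    trilin HHH (ww 1 2 * ww 1 2 * pw 1 0 * pw 0 0),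
    trilin HHH (ww 1 2 * ww 1 2 * pw 2 0 * pw 1 0),
    trilin HHH (pw 1 2 * pw 0 1 * ww 0 1 * ww 0 2),
    trilin HHH (pw 2 2 * pw 0 1 * ww 0 1 * ww 0 2),
    trilin HHH (pw 2 2 * pw 1 1 * ww 0 1 * ww 0 2),
    trilin HHH (pw 1 2 * pw 2 1 * ww 0 1 * ww 0 2),
    trilin UTH (pw 0 2 * ww 1 2 * pw 1 0),
    trilin UTH (pw 0 2 * ww 1 2 * pw 2 0),
    trilin UTH (pw 1 2 * ww 1 2 * pw 2 0),
    trilin UTH (pw 1 2 * ww 1 2 * pw 0 0),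
    trilin UTH (pw 2 2 * ww 1 2 * pw 0 0),
    trilin UTH (pw 2 2 * ww 1 2 * pw 1 0),
    trilin UTH (ww 2 2 * pw 0 1 * pw 1 0),
    trilin UTH (ww 2 2 * pw 0 1 * pw 2 0),
    trilin UTH (ww 2 2 * pw 1 1 * pw 2 0),
    trilin UTH (ww 2 2 * pw 1 1 * pw 0 0),
    trilin UTH (ww 2 2 * pw 2 1 * pw 0 0),
    trilin UTH (ww 2 2 * pw 2 1 * pw 1 0),
    trilin UTH (pw 1 2 * pw 0 1 * ww 0 2),
    trilin UTH (pw 2 2 * pw 0 1 * ww 0 2),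
    trilin UTH (pw 2 2 * pw 1 1 * ww 0 2),
    trilin UTH (pw 0 2 * pw 1 1 * ww 0 2),
    trilin UTH (pw 0 2 * pw 2 1 * ww 0 2),
    trilin UTH (pw 1 2 * pw 2 1 * ww 0 2),
    trilin UTH (pw 0 2 * ww 0 1 * pw 1 2),
    trilin UTH (pw 0 2 * ww 0 1 * pw 2 2),
    trilin UTH (pw 1 2 * ww 0 1 * pw 2 2)] := by
  unfold monomial
  iterate 33
    refine congrArg₂ Matrix.vecCons ?_ ?_
    swap
  · rfl
  all_goals
    simp only [pw, ww, tr, Finset.sum_mul, Finset.mul_sum, map_sum, Finset.smul_sum]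
    refine Finset.sum_congr rfl fun _ _ => Finset.sum_congr rfl fun _ _ =>
      Finset.sum_congr rfl fun _ _ => ?_
    try refine Finset.sum_congr rfl fun _ _ => ?_
    simp only [mul_smul_comm, smul_mul_assoc, hhh_eq, uth_eq, ← map_smul]
    refine congrArg _ ?_
    simp only [smul_eq_C_mul, C_mul, Multiset.map_singleton, Multiset.prod_singleton,
      Multiset.map_zero, Multiset.prod_zero]
    ring

/-- The symbol of the `hhh` part of the coupling. -/
def symbolHHH (c : Fin 33 → ℂ) : Symbols :=
  c 0 • (ww 1 1 * ww 2 2 * pw 1 0 * pw 0 0) +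
  c 1 • (ww 1 1 * ww 2 2 * pw 2 0 * pw 1 0) +
  c 2 • (ww 2 2 * pw 1 1 * ww 0 1 * pw 0 0) +
  c 3 • (ww 2 2 * pw 2 1 * ww 0 1 * pw 0 0) +
  c 4 • (ww 2 2 * pw 2 1 * ww 0 1 * pw 1 0) +
  c 5 • (ww 2 2 * pw 0 1 * ww 0 1 * pw 1 0) +
  c 6 • (ww 1 2 * ww 1 2 * pw 1 0 * pw 0 0) +
  c 7 • (ww 1 2 * ww 1 2 * pw 2 0 * pw 1 0) +
  c 8 • (pw 1 2 * pw 0 1 * ww 0 1 * ww 0 2) +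
  c 9 • (pw 2 2 * pw 0 1 * ww 0 1 * ww 0 2) +
  c 10 • (pw 2 2 * pw 1 1 * ww 0 1 * ww 0 2) +
  c 11 • (pw 1 2 * pw 2 1 * ww 0 1 * ww 0 2)

/-- The symbol of the `uũh` part of the coupling. -/
def symbolUTH (c : Fin 33 → ℂ) : Symbols :=
  c 12 • (pw 0 2 * ww 1 2 * pw 1 0) +
  c 13 • (pw 0 2 * ww 1 2 * pw 2 0) +
  c 14 • (pw 1 2 * ww 1 2 * pw 2 0) +
  c 15 • (pw 1 2 * ww 1 2 * pw 0 0) +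
  c 16 • (pw 2 2 * ww 1 2 * pw 0 0) +
  c 17 • (pw 2 2 * ww 1 2 * pw 1 0) +
  c 18 • (ww 2 2 * pw 0 1 * pw 1 0) +
  c 19 • (ww 2 2 * pw 0 1 * pw 2 0) +
  c 20 • (ww 2 2 * pw 1 1 * pw 2 0) +
  c 21 • (ww 2 2 * pw 1 1 * pw 0 0) +
  c 22 • (ww 2 2 * pw 2 1 * pw 0 0) +
  c 23 • (ww 2 2 * pw 2 1 * pw 1 0) +
  c 24 • (pw 1 2 * pw 0 1 * ww 0 2) +
  c 25 • (pw 2 2 * pw 0 1 * ww 0 2) +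
  c 26 • (pw 2 2 * pw 1 1 * ww 0 2) +
  c 27 • (pw 0 2 * pw 1 1 * ww 0 2) +
  c 28 • (pw 0 2 * pw 2 1 * ww 0 2) +
  c 29 • (pw 1 2 * pw 2 1 * ww 0 2) +
  c 30 • (pw 0 2 * ww 0 1 * pw 1 2) +
  c 31 • (pw 0 2 * ww 0 1 * pw 2 2) +
  c 32 • (pw 1 2 * ww 0 1 * pw 2 2)

theorem coupling_eq (c : Fin 33 → ℝ) : coupling c =
    trilin HHH (symbolHHH fun i => (c i : ℂ)) + trilin UTH (symbolUTH fun i => (c i : ℂ)) := by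
  rw [coupling, monomial_eq]
  simp only [symbolHHH, symbolUTH, map_add, map_smul, add_assoc, Fin.sum_univ_succ,
    Finset.univ_eq_empty, Finset.sum_empty, add_zero]
  rfl

/-! ### Derivatives with respect to polarizations -/

theorem ww_comm (i j : Fin 3) : ww i j = ww j i :=
  Finset.sum_congr rfl fun _ _ => by ring

theorem pp_comm (i j : Fin 3) : pp i j = pp j i :=
  Finset.sum_congr rfl fun _ _ => by ring

theorem C_eta_mul_self (μ : Fin 4) : (C (eta μ) * C (eta μ) : Symbols) = 1 := by
  rw [← C_mul, eta_mul_self, C_1]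

theorem pderiv_pw (i k j : Fin 3) (ν : Fin 4) :
    pderiv (.inr (j, ν)) (pw i k) = if k = j then P i ν else 0 := by
  simp only [pw, map_sum, Derivation.leibniz, P, W, pderiv_X, smul_eq_mul]
  rcases eq_or_ne k j with rfl | hk
  · simp [Pi.single_apply, eq_comm]
  · simp [hk]

theorem pderiv_ww (i k j : Fin 3) (ν : Fin 4) :
    pderiv (.inr (j, ν)) (ww i k) =
      (if i = j then C (eta ν) * W k ν else 0) + if k = j then C (eta ν) * W i ν else 0 := by
  have e : ∀ b μ, pderiv (.inr (j, ν)) (W b μ) = if μ = ν ∧ b = j then 1 else 0 := by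
    intro b μ
    simp [W, pderiv_X, Pi.single_apply, and_comm]
  simp only [ww, map_sum, Derivation.leibniz, e, pderiv_C, smul_eq_mul, mul_zero, add_zero,
    Finset.sum_add_distrib, ite_and, mul_ite, mul_one, Finset.sum_ite_eq', Finset.mem_univ, if_true]
  rw [add_comm]
  congr 1
  split_ifs
  · ring
  · rfl

/-- The momentum `p_i` with its index raised by `η`, as a direction for polarization vectors. -/
def momentum (i : Fin 3) (μ : Fin 4) : Symbols := C (eta μ) * P i μ

theorem dir_momentum_pw (a i k j : Fin 3) :
    dir j (momentum a) (pw i k) = if k = j then pp i a else 0 := by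
  simp only [dir_apply, pderiv_pw, momentum]
  split
  · exact Finset.sum_congr rfl fun _ _ => by ring
  · simp

theorem dir_W_pw (a i k j : Fin 3) :
    dir j (W a) (pw i k) = if k = j then pw i a else 0 := by
  simp only [dir_apply, pderiv_pw]
  split
  · exact Finset.sum_congr rfl fun _ _ => by ring
  · simp

theorem dir_momentum_ww (a i k j : Fin 3) :
    dir j (momentum a) (ww i k) = (if i = j then pw a k else 0) + if k = j then pw a i else 0 := by
  have e : ∀ b, ∑ ν, momentum a ν * (C (eta ν) * W b ν) = pw a b := fun b =>
    Finset.sum_congr rfl fun ν _ => by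
      rw [momentum]
      linear_combination P a ν * W b ν * C_eta_mul_self ν
  simp only [dir_apply, pderiv_ww, mul_add, mul_ite, mul_zero, Finset.sum_add_distrib]
  congr 1 <;> split_ifs <;> simp [e]

theorem dir_W_ww (a i k j : Fin 3) :
    dir j (W a) (ww i k) = (if i = j then ww a k else 0) + if k = j then ww a i else 0 := by
  have e : ∀ b, ∑ ν, W a ν * (C (eta ν) * W b ν) = ww a b := fun b =>
    Finset.sum_congr rfl fun ν _ => by ring
  simp only [dir_apply, pderiv_ww, mul_add, mul_ite, mul_zero, Finset.sum_add_distrib]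
  congr 1 <;> split_ifs <;> simp [e]

/-- The contraction by `η` of the gradients of two symbols with respect to `w_j`, that is, the mixed
term in the Leibniz rule of `lap`. -/
def grad (j : Fin 3) (f g : Symbols) : Symbols :=
  ∑ μ, C (eta μ) * pderiv (.inr (j, μ)) f * pderiv (.inr (j, μ)) g

theorem grad_mul (j : Fin 3) (f f' g : Symbols) :
    grad j (f * f') g = f * grad j f' g + f' * grad j f g := by
  simp only [grad, Finset.mul_sum, ← Finset.sum_add_distrib, Derivation.leibniz, smul_eq_mul]
  exact Finset.sum_congr rfl fun _ _ => by ring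

theorem grad_pw (i k j : Fin 3) (g : Symbols) :
    grad j (pw i k) g = if k = j then dir j (momentum i) g else 0 := by
  simp only [grad, pderiv_pw, dir_apply, momentum]
  split_ifs <;> simp

theorem grad_ww (i k j : Fin 3) (g : Symbols) :
    grad j (ww i k) g =
      (if i = j then dir j (W k) g else 0) + if k = j then dir j (W i) g else 0 := by
  have e : ∀ b ν, C (eta ν) * (C (eta ν) * W b ν) = W b ν := fun b ν => by
    rw [← mul_assoc, C_eta_mul_self, one_mul]
  simp only [grad, pderiv_ww, dir_apply, mul_add, add_mul, mul_ite, mul_zero, ite_mul, zero_mul, e,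
    Finset.sum_add_distrib]
  congr 1 <;> split_ifs <;> simp

theorem lap_mul (j : Fin 3) (f g : Symbols) :
    lap j (f * g) = f * lap j g + g * lap j f + (grad j f g + grad j f g) := by
  simp only [lap, grad, LinearMap.sum_apply, LinearMap.smul_apply, LinearMap.comp_apply,
    Derivation.coeFn_coe, Derivation.leibniz, smul_eq_mul, map_add, Finset.mul_sum, smul_eq_C_mul,
    ← Finset.sum_add_distrib]
  exact Finset.sum_congr rfl fun _ _ => by ring

theorem lap_pw (i k j : Fin 3) : lap j (pw i k) = 0 := by
  simp only [lap, LinearMap.sum_apply, LinearMap.smul_apply, LinearMap.comp_apply,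
    Derivation.coeFn_coe, pderiv_pw]
  refine Finset.sum_eq_zero fun μ _ => ?_
  split_ifs <;> simp [P, pderiv_X]

theorem lap_ww (i k j : Fin 3) : lap j (ww i k) = if i = j ∧ k = j then 8 else 0 := by
  have e : ∀ μ (b : Fin 3), pderiv (.inr (j, μ)) (C (eta μ) * W b μ) =
      if b = j then C (eta μ) else 0 := fun μ b => by
    simp [W, pderiv_X, Pi.single_apply, eq_comm]
  have e' : ∀ μ, eta μ • (C (eta μ) : Symbols) = 1 := fun μ => by
    rw [smul_eq_C_mul, C_eta_mul_self]
  simp only [lap, LinearMap.sum_apply, LinearMap.smul_apply, LinearMap.comp_apply,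
    Derivation.coeFn_coe, pderiv_ww, map_add, smul_add, Finset.sum_add_distrib,
    apply_ite (pderiv _), e, map_zero, smul_ite, e', smul_zero]
  by_cases hi : i = j <;> by_cases hk : k = j <;> simp [hi, hk]
  norm_num

theorem vary_H (j : Fin 3) (f : Symbols) : vary j .H f =
    (-(1 / 2) : ℂ) • dir j (momentum j) f + (1 / 4 : ℂ) • (pw j j * lap j f) := rfl

theorem vary_T (j : Fin 3) (f : Symbols) : vary j .T f = pw j j * f := rfl

/-! ### Gauge variation of the trilinear sectors -/

/-- The field content `uhh`. -/
def UHH : Fin 3 → Kind := ![.U, .H, .H]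

/-- The field content `uuũ`. -/
def UUT : Fin 3 → Kind := ![.U, .U, .T]

/-- The field content `ũhh`. -/
def THH : Fin 3 → Kind := ![.T, .H, .H]

/-- The field content `uũũ`. -/
def UTT : Fin 3 → Kind := ![.U, .T, .T]

@[simp] theorem s01_zero : s01 0 = 1 := by decide
@[simp] theorem s01_one : s01 1 = 0 := by decide
@[simp] theorem s01_two : s01 2 = 2 := by decide
@[simp] theorem s12_zero : s12 0 = 0 := by decide
@[simp] theorem s12_one : s12 1 = 2 := by decide
@[simp] theorem s12_two : s12 2 = 1 := by decide

@[simp] theorem neg_one_smul_wick (F : Wick) : (-1 : ℂ) • F = -F := by module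

theorem trilin_s01 {K K' : Fin 3 → Kind} (hK : K ∘ s01 = K') (f : Symbols) :
    trilin K' f = sgn (K 0).odd (K 1).odd • trilin K (perm s01 f) := by
  rw [trilin_perm_s01, smul_smul, sgn_mul_self, one_smul, hK]

theorem trilin_s12 {K K' : Fin 3 → Kind} (hK : K ∘ s12 = K') (f : Symbols) :
    trilin K' f = sgn (K 1).odd (K 2).odd • trilin K (perm s12 f) := by
  rw [trilin_perm_s12, smul_smul, sgn_mul_self, one_smul, hK]

theorem dQ_trilin_HHH (f : Symbols) : dQ (trilin HHH f) = Complex.I • trilin UHH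
    (vary 0 .H f + perm s01 (vary 1 .H f) + perm s01 (perm s12 (vary 2 .H f))) := by
  have k0 : update HHH 0 .U = UHH := by decide
  have k1 (f) : trilin (update HHH 1 .U) f = trilin UHH (perm s01 f) := by
    rw [trilin_s01 (K := UHH) (by decide)]; simp [UHH, Kind.odd, sgn]
  have k2 (f) : trilin (update HHH 2 .U) f = trilin UHH (perm s01 (perm s12 f)) := by
    rw [← k1, trilin_s12 (K := update HHH 1 .U) (by decide)]; simp [HHH, Kind.odd, sgn]
  rw [dQ_trilin]
  simp only [show ∀ j, HHH j = .H by decide, Kind.next, k0, k1, k2, Kind.odd, sgn,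
    Bool.and_false, Bool.false_eq_true, if_false, one_smul, mul_one, map_add]

theorem dQ_trilin_UTH (f : Symbols) : dQ (trilin UTH f) = Complex.I •
    (trilin UHH (-(pw 1 1 * f)) + trilin UUT (-perm s12 (vary 2 .H f))) := by
  have k1 : update UTH 1 .H = UHH := by decide
  have k2 (f) : trilin (update UTH 2 .U) f = -trilin UUT (perm s12 f) := by
    rw [trilin_s12 (K := UUT) (by decide)]; simp [UUT, Kind.odd, sgn]
  rw [dQ_trilin]
  simp only [show UTH 0 = .U by decide, show UTH 1 = .T by decide, show UTH 2 = .H by decide,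
    Kind.next, k1, k2, Kind.odd, sgn, vary, map_neg]
  simp

theorem dQ_trilin_THH (f : Symbols) : dQ (trilin THH f) = Complex.I • (trilin HHH (pw 0 0 * f) +
    trilin UTH (perm s01 (vary 1 .H f) + perm s01 (perm s12 (vary 2 .H f)))) := by
  have k0 : update THH 0 .H = HHH := by decide
  have k1 (f) : trilin (update THH 1 .U) f = -trilin UTH (perm s01 f) := by
    rw [trilin_s01 (K := UTH) (by decide)]; simp [UTH, Kind.odd, sgn]
  have k2 (f) : trilin (update THH 2 .U) f = -trilin UTH (perm s01 (perm s12 f)) := by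
    rw [← k1, trilin_s12 (K := update THH 1 .U) (by decide)]; simp [THH, Kind.odd, sgn]
  rw [dQ_trilin]
  simp only [show THH 0 = .T by decide, show THH 1 = .H by decide, show THH 2 = .H by decide,
    Kind.next, k0, k1, k2, vary_T, Kind.odd, sgn, map_add]
  simp [add_assoc]

theorem dQ_trilin_UTT (f : Symbols) : dQ (trilin UTT f) = Complex.I •
    trilin UTH (pw 2 2 * f - perm s12 (pw 1 1 * f)) := by
  have k1 (f) : trilin (update UTT 1 .H) f = trilin UTH (perm s12 f) := by
    rw [trilin_s12 (K := UTH) (by decide)]; simp [UTH, Kind.odd, sgn]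
  have k2 : update UTT 2 .H = UTH := by decide
  rw [dQ_trilin]
  simp only [show UTT 0 = .U by decide, show UTT 1 = .T by decide, show UTT 2 = .T by decide,
    Kind.next, k1, k2, Kind.odd, sgn, map_sub, vary]
  simp [sub_eq_neg_add]

/-! ### On-shell symbols -/

/-- Symbols modulo momentum conservation and the mass shell condition. -/
def OnShell : Type := Symbols ⧸ kinematic

instance : CommRing OnShell := inferInstanceAs (CommRing (Symbols ⧸ kinematic))

instance : Algebra ℂ OnShell := inferInstanceAs (Algebra ℂ (Symbols ⧸ kinematic))

/-- The class of a symbol on shell. -/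
def cls : Symbols →ₐ[ℂ] OnShell := Ideal.Quotient.mkₐ ℂ kinematic

theorem trilin_mem_of_cls {K : Fin 3 → Kind} {f : Symbols} (hf : cls f = 0) :
    trilin K f ∈ divergences :=
  trilin_mem_divergences K (Ideal.Quotient.eq_zero_iff_mem.1 hf)

theorem cls_P_zero (μ : Fin 4) : cls (P 0 μ) = -cls (P 1 μ) - cls (P 2 μ) := by
  have : cls (∑ j, P j μ) = 0 :=
    Ideal.Quotient.eq_zero_iff_mem.2 (Ideal.subset_span (.inl ⟨μ, rfl⟩))
  rw [Fin.sum_univ_three, map_add, map_add] at this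
  linear_combination this

theorem cls_pw_zero (j : Fin 3) : cls (pw 0 j) = -cls (pw 1 j) - cls (pw 2 j) := by
  simp only [pw, map_sum, map_mul, cls_P_zero, ← Finset.sum_neg_distrib, ← Finset.sum_sub_distrib]
  exact Finset.sum_congr rfl fun _ _ => by ring

/-- For three null momenta of sum zero all contractions of momenta vanish. -/
theorem cls_pp (i j : Fin 3) : cls (pp i j) = 0 := by
  have hd : ∀ j, cls (pp j j) = 0 := fun j =>
    Ideal.Quotient.eq_zero_iff_mem.2 (Ideal.subset_span (.inr ⟨j, rfl⟩))
  have h0 : ∀ j, cls (pp 0 j) = -cls (pp 1 j) - cls (pp 2 j) := by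
    intro j
    simp only [pp, map_sum, map_mul, cls_P_zero, ← Finset.sum_neg_distrib,
      ← Finset.sum_sub_distrib]
    exact Finset.sum_congr rfl fun _ _ => by ring
  have e0 := h0 0
  have e1 := h0 1
  have e2 := h0 2
  rw [pp_comm 1 0, pp_comm 2 0, hd] at e0
  rw [pp_comm 2 1, hd] at e1
  rw [hd] at e2
  have two : ∀ x : OnShell, 2 * x = 0 → x = 0 := by
    intro x hx
    have hc : cls (C (1 / 2)) * 2 = 1 := by
      rw [← map_ofNat cls 2, ← map_mul, ← map_ofNat C 2, ← C_mul]
      norm_num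
    linear_combination cls (C (1 / 2)) * hx - x * hc
  have h12 : cls (pp 1 2) = 0 := two _ (by linear_combination -e0 + e1 + e2)
  have h01 : cls (pp 0 1) = 0 := by linear_combination e1 - h12
  have h02 : cls (pp 0 2) = 0 := by linear_combination e2 - h12
  match i, j with
  | 0, 0 => exact hd 0
  | 0, 1 => exact h01
  | 0, 2 => exact h02
  | 1, 0 => exact pp_comm 0 1 ▸ h01
  | 1, 1 => exact hd 1
  | 1, 2 => exact h12
  | 2, 0 => exact pp_comm 0 2 ▸ h02
  | 2, 1 => exact pp_comm 1 2 ▸ h12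
  | 2, 2 => exact hd 2

/-- A product of three tensor fields is a divergence if its symbol, symmetrized over the slots,
vanishes on shell. -/
theorem trilin_HHH_mem {f : Symbols} (hf : cls (f + perm s01 f + perm s12 f +
    perm s01 (perm s12 f) + perm s12 (perm s01 f) + perm s01 (perm s12 (perm s01 f))) = 0) :
    trilin HHH f ∈ divergences := by
  have h1 (f) : trilin HHH (perm s01 f) = trilin HHH f := by
    rw [trilin_s01 (K := HHH) (f := f) (by decide)]; simp [HHH, Kind.odd, sgn]
  have h2 (f) : trilin HHH (perm s12 f) = trilin HHH f := by
    rw [trilin_s12 (K := HHH) (f := f) (by decide)]; simp [HHH, Kind.odd, sgn]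
  have := trilin_mem_of_cls (K := HHH) hf
  simp only [map_add, h1, h2] at this
  convert divergences.smul_mem (1 / 6 : ℂ) this using 1
  module

theorem trilin_UHH_mem {f : Symbols} (hf : cls (f + perm s12 f) = 0) :
    trilin UHH f ∈ divergences := by
  have h2 : trilin UHH (perm s12 f) = trilin UHH f := by
    rw [trilin_s12 (K := UHH) (f := f) (by decide)]; simp [UHH, Kind.odd, sgn]
  have := trilin_mem_of_cls (K := UHH) hf
  rw [map_add, h2] at this
  convert divergences.smul_mem (1 / 2 : ℂ) this using 1
  module

theorem trilin_UUT_mem {f : Symbols} (hf : cls (f - perm s01 f) = 0) :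
    trilin UUT f ∈ divergences := by
  have h2 : trilin UUT (perm s01 f) = -trilin UUT f := by
    rw [trilin_s01 (K := UUT) (f := f) (by decide)]; simp [UUT, Kind.odd, sgn]
  have := trilin_mem_of_cls (K := UUT) hf
  rw [map_sub, h2] at this
  convert divergences.smul_mem (1 / 2 : ℂ) this using 1
  module

theorem perm_eight (e : Fin 3 → Fin 3) : perm e 8 = 8 := map_ofNat (perm e) 8

theorem cls_eight : cls 8 = 8 := map_ofNat cls 8

/-- Four times the gauge variation of a tensor field in slot `j`, to keep coefficients integral. -/
def qvary (j : Fin 3) : Symbols →ₗ[ℂ] Symbols :=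
  LinearMap.mulLeft ℂ (pw j j) ∘ₗ lap j - (2 : ℂ) • (dir j (momentum j) : Symbols →ₗ[ℂ] Symbols)

theorem qvary_apply (j : Fin 3) (f : Symbols) :
    qvary j f = pw j j * lap j f - (dir j (momentum j) f + dir j (momentum j) f) := by
  simp [qvary, two_smul]

theorem vary_H_eq (j : Fin 3) (f : Symbols) : vary j .H f = (1 / 4 : ℂ) • qvary j f := by
  rw [vary_H, qvary_apply, smul_sub, sub_eq_neg_add]
  congr 1
  module

/-! ### Coboundaries among the couplings -/

/-- The sum of a symbol over all permutations of the slots, on shell. -/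
def symmetrize : Symbols →ₗ[ℂ] OnShell :=
  cls.toLinearMap ∘ₗ (LinearMap.id + (perm s01).toLinearMap + (perm s12).toLinearMap +
    ((perm s01).comp (perm s12)).toLinearMap + ((perm s12).comp (perm s01)).toLinearMap +
    ((perm s01).comp ((perm s12).comp (perm s01))).toLinearMap)

theorem symmetrize_apply (f : Symbols) : symmetrize f =
    cls (f + perm s01 f + perm s12 f + perm s01 (perm s12 f) + perm s12 (perm s01 f) +
        perm s01 (perm s12 (perm s01 f))) := rfl

/-- Four times the on-shell symbol of the `uũh` part of the gauge variation of a `ũhh` product, up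
to the factor `i`. -/
def ghostTHH : Symbols →ₗ[ℂ] OnShell :=
  cls.toLinearMap ∘ₗ ((perm s01).toLinearMap ∘ₗ (qvary 1 + (perm s12).toLinearMap ∘ₗ qvary 2))

theorem ghostTHH_apply (f : Symbols) : ghostTHH f =
    cls (perm s01 (qvary 1 f) + perm s01 (perm s12 (qvary 2 f))) := by
  simp [ghostTHH]

/-- The on-shell symbol of the gauge variation of a `uũũ` product, up to the factor `i`. -/
def ghostUTT : Symbols →ₗ[ℂ] OnShell :=
  cls.toLinearMap ∘ₗ (LinearMap.mulLeft ℂ (pw 2 2) -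
    (perm s12).toLinearMap ∘ₗ LinearMap.mulLeft ℂ (pw 1 1))

theorem ghostUTT_apply (f : Symbols) : ghostUTT f = cls (pw 2 2 * f - perm s12 (pw 1 1 * f)) := by
  simp [ghostUTT]

theorem four_coupling_eq (c : Fin 33 → ℝ) : (4 : ℂ) • coupling c =
    trilin HHH (symbolHHH fun i => ((4 * c i : ℝ) : ℂ)) +
      trilin UTH (symbolUTH fun i => ((4 * c i : ℝ) : ℂ)) := by
  rw [← Complex.ofReal_ofNat 4, ← coupling_smul, coupling_eq]
  rfl

theorem mem_of_four_smul_mem {F : Wick} (h : (4 : ℂ) • F ∈ divergences) : F ∈ divergences := by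
  have := divergences.smul_mem (1 / 4 : ℂ) h
  rw [smul_smul] at this
  norm_num at this
  exact this

/-- A criterion in terms of symbols for a coupling to be a coboundary plus a divergence. The
constant `-i/4` cancels the `i` in `d_Q` and the factor `4` of the symbols `x` and `y`. -/
theorem coupling_sub_dQ_mem (c : Fin 33 → ℝ) (x y : Symbols)
    (hH : symmetrize (symbolHHH fun i => ((4 * c i : ℝ) : ℂ)) = symmetrize (pw 0 0 * x))
    (hU : (4 : ℂ) • cls (symbolUTH fun i => ((4 * c i : ℝ) : ℂ)) =
      ghostTHH x + (4 : ℂ) • ghostUTT y) :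
    coupling c - dQ ((-(Complex.I / 4)) • (trilin THH x + trilin UTT y)) ∈ divergences := by
  rw [← sub_eq_zero, ← map_sub, symmetrize_apply] at hH
  rw [← sub_eq_zero, ghostTHH_apply, ghostUTT_apply, ← map_smul, ← map_smul, ← map_add,
    ← map_sub] at hU
  have h1 := trilin_HHH_mem hH
  have h2 := divergences.smul_mem (1 / 4 : ℂ) (trilin_mem_of_cls (K := UTH) hU)
  apply mem_of_four_smul_mem
  convert add_mem h1 h2 using 1
  have e : (4 : ℂ) * (-(Complex.I / 4) * Complex.I) = 1 := by
    linear_combination -Complex.I_mul_I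
  rw [smul_sub, four_coupling_eq, map_smul, map_add, dQ_trilin_THH, dQ_trilin_UTT, ← smul_add,
    smul_smul (-(Complex.I / 4)), smul_smul 4, e, one_smul, vary_H_eq, vary_H_eq]
  simp only [map_sub, map_add, map_smul, smul_sub, smul_add, smul_smul]
  norm_num
  module

theorem ww_one_zero : ww 1 0 = ww 0 1 := ww_comm 1 0
theorem ww_two_zero : ww 2 0 = ww 0 2 := ww_comm 2 0
theorem ww_two_one : ww 2 1 = ww 1 2 := ww_comm 2 1

/-- The symbol of the `ũhh` part of `4i Xᵢ`, where `T₁(vᵢ) - d_Q Xᵢ` is a divergence. -/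
def potentialTHH : Fin 17 → Symbols := ![0, 0, 0, 0, 0,
  (4 : ℂ) • (pw 1 1 * ww 0 1 * ww 2 2),
  0,
  (-8 : ℂ) • (pw 0 1 * ww 0 1 * ww 2 2) + (-8 : ℂ) • (pw 1 1 * ww 0 1 * ww 2 2),
  (2 : ℂ) • (pw 0 0 * ww 1 1 * ww 2 2),
  0,
  (-8 : ℂ) • (pw 0 1 * ww 0 2 * ww 1 2) + (-6 : ℂ) • (pw 1 1 * ww 0 1 * ww 2 2),
  0, 0,
  (2 : ℂ) • (pw 1 1 * ww 0 1 * ww 2 2) + (-4 : ℂ) • (pw 1 1 * ww 0 2 * ww 1 2),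
  0,
  (1 : ℂ) • (pw 0 0 * ww 1 1 * ww 2 2) + (-2 : ℂ) • (pw 0 0 * ww 1 2 * ww 1 2),
  0]

/-- The symbol of the `uũũ` part of `4i Xᵢ`, where `T₁(vᵢ) - d_Q Xᵢ` is a divergence. -/
def potentialUTT : Fin 17 → Symbols := ![0, 0, (4 : ℂ) • (pw 1 0 * ww 1 2), 0,
  (4 : ℂ) • (pw 1 0 * ww 1 2), 0, 0, 0, 0, 0,
  (-2 : ℂ) • (pw 1 0 * ww 1 2),
  (4 : ℂ) • (pw 0 1 * ww 0 2) + (4 : ℂ) • (pw 1 1 * ww 0 2),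
  (4 : ℂ) • (pw 0 1 * ww 0 2),
  (-2 : ℂ) • (pw 0 1 * ww 0 2),
  0, 0,
  (-4 : ℂ) • (pw 0 1 * ww 0 2)]

theorem algebraMap_two : algebraMap ℂ OnShell 2 = 2 := map_ofNat _ 2
theorem algebraMap_three : algebraMap ℂ OnShell 3 = 3 := map_ofNat _ 3
theorem algebraMap_four : algebraMap ℂ OnShell 4 = 4 := map_ofNat _ 4
theorem algebraMap_six : algebraMap ℂ OnShell 6 = 6 := map_ofNat _ 6
theorem algebraMap_eight : algebraMap ℂ OnShell 8 = 8 := map_ofNat _ 8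

set_option maxHeartbeats 1000000 in
/-- The `hhh` parts of `T₁(vᵢ)` and of the variation of its potential agree on shell. -/
theorem balance_HHH (i : Fin 17) : symmetrize (symbolHHH fun j => ((4 * v i j : ℝ) : ℂ)) =
    symmetrize (pw 0 0 * potentialTHH i) := by
  fin_cases i <;> simp [v, symbolHHH, potentialTHH, mul_add, -neg_smul] <;>
    norm_num [-neg_smul] <;>
    simp only [symmetrize_apply, map_add, map_mul, perm_pw, perm_ww, s01_zero, s01_one, s01_two,
      s12_zero, s12_one, s12_two, cls_pw_zero, ww_one_zero, ww_two_one, Algebra.smul_def, map_neg,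
      algebraMap_two, algebraMap_four, algebraMap_six, algebraMap_eight]
  -- The classes are generalized so that `ring` does not try to unify them by unfolding.
  all_goals
    generalize cls (pw 1 0) = p₁₀, cls (pw 1 1) = p₁₁, cls (pw 1 2) = p₁₂,
      cls (pw 2 0) = p₂₀, cls (pw 2 1) = p₂₁, cls (pw 2 2) = p₂₂, cls (ww 0 0) = w₀₀,
      cls (ww 0 1) = w₀₁, cls (ww 0 2) = w₀₂, cls (ww 1 1) = w₁₁, cls (ww 1 2) = w₁₂,
      cls (ww 2 2) = w₂₂
    ring

set_option maxHeartbeats 1000000 in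
/-- The `uũh` parts of `T₁(vᵢ)` and of the variation of its potential agree on shell. -/
theorem balance_UTH (i : Fin 17) : (4 : ℂ) • cls (symbolUTH fun j => ((4 * v i j : ℝ) : ℂ)) =
    ghostTHH (potentialTHH i) + (4 : ℂ) • ghostUTT (potentialUTT i) := by
  fin_cases i <;> simp [v, symbolUTH, potentialTHH, potentialUTT, -neg_smul] <;>
    norm_num [-neg_smul] <;>
    try simp [ghostTHH_apply, ghostUTT_apply, qvary_apply, lap_mul, grad_mul, grad_pw, grad_ww,
      lap_pw, lap_ww, dir_momentum_pw, dir_momentum_ww, dir_W_ww, perm_eight, cls_eight, -neg_smul]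
  all_goals
    simp only [cls_pw_zero, cls_pp, ww_one_zero, ww_two_zero, ww_two_one, Algebra.smul_def,
      map_neg, algebraMap_two, algebraMap_four, algebraMap_six, algebraMap_eight]
    generalize cls (pw 1 0) = p₁₀, cls (pw 1 1) = p₁₁, cls (pw 1 2) = p₁₂,
      cls (pw 2 0) = p₂₀, cls (pw 2 1) = p₂₁, cls (pw 2 2) = p₂₂, cls (ww 0 0) = w₀₀,
      cls (ww 0 1) = w₀₁, cls (ww 0 2) = w₀₂, cls (ww 1 1) = w₁₁, cls (ww 1 2) = w₁₂,
      cls (ww 2 2) = w₂₂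
    ring

/-! ### Degrees of symbols and the potentials -/

/-- Symbols that are homogeneous of degree `d j` in the polarization vector of each slot `j` and of
total degree `n` in the momenta. -/
def graded (d : Fin 3 → ℕ) (n : ℕ) : Submodule ℂ Symbols :=
  Submodule.span ℂ {f | ∃ s I : Fin 3 → Multiset (Fin 4),
    (∀ j, (s j).card = d j) ∧ ∑ j, (I j).card = n ∧ f = slots s I}

theorem graded_le {d : Fin 3 → ℕ} {n : ℕ} (S : Submodule ℂ Symbols)
    (hS : ∀ s I : Fin 3 → Multiset (Fin 4), (∀ j, (s j).card = d j) → ∑ j, (I j).card = n →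
      slots s I ∈ S) {f : Symbols} (hf : f ∈ graded d n) : f ∈ S := by
  refine (Submodule.span_le (p := S)).2 ?_ hf
  rintro _ ⟨s, I, hs, hI, rfl⟩
  exact hS s I hs hI

theorem slots_mem_graded {d : Fin 3 → ℕ} {n : ℕ} {s I : Fin 3 → Multiset (Fin 4)}
    (hs : ∀ j, (s j).card = d j) (hI : ∑ j, (I j).card = n) : slots s I ∈ graded d n :=
  Submodule.subset_span ⟨s, I, hs, hI, rfl⟩

theorem graded_congr {d d' : Fin 3 → ℕ} {n n' : ℕ} {f : Symbols} (hf : f ∈ graded d n)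
    (hd : d = d') (hn : n = n') : f ∈ graded d' n' := by
  rwa [← hd, ← hn]

theorem slots_mul_slots (s I s' I' : Fin 3 → Multiset (Fin 4)) :
    slots s I * slots s' I' = slots (s + s') (I + I') := by
  rw [slots, slots, monomial_mul, one_mul, slots]
  refine congrArg (MvPolynomial.monomial · 1) (Finsupp.ext fun i => ?_)
  rcases i with i | i <;> simp

theorem graded_mul {d d' : Fin 3 → ℕ} {n n' : ℕ} {f g : Symbols} (hf : f ∈ graded d n)
    (hg : g ∈ graded d' n') : f * g ∈ graded (d + d') (n + n') := by
  refine graded_le ((graded (d + d') (n + n')).comap (LinearMap.mulRight ℂ g))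
    (fun s I hs hI => ?_) hf
  refine graded_le ((graded (d + d') (n + n')).comap (LinearMap.mulLeft ℂ (slots s I)))
    (fun s' I' hs' hI' => ?_) hg
  rw [Submodule.mem_comap, LinearMap.mulLeft_apply, slots_mul_slots]
  exact slots_mem_graded (by simp [hs, hs']) (by simp [← hI, ← hI', Finset.sum_add_distrib])

theorem P_mem (j : Fin 3) (μ : Fin 4) : P j μ ∈ graded 0 1 := by
  rw [← mul_one (P j μ), ← slots_zero, P_mul_slots]
  refine slots_mem_graded (fun _ => rfl) ?_
  rw [Finset.sum_eq_single j (fun k _ hk => by simp [hk]) (by simp)]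
  simp

theorem W_mem (j : Fin 3) (μ : Fin 4) : W j μ ∈ graded (Pi.single j 1) 0 := by
  rw [← mul_one (W j μ), ← slots_zero, W_mul_slots]
  refine slots_mem_graded (fun k => ?_) rfl
  rcases eq_or_ne k j with rfl | hk
  · simp
  · simp [hk]

theorem pw_mem (i j : Fin 3) : pw i j ∈ graded (Pi.single j 1) 1 :=
  Submodule.sum_mem _ fun μ _ =>
    graded_congr (graded_mul (P_mem i μ) (W_mem j μ)) (zero_add _) rfl

theorem ww_mem (i j : Fin 3) : ww i j ∈ graded (Pi.single i 1 + Pi.single j 1) 0 := by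
  rw [ww]
  refine Submodule.sum_mem _ fun μ _ => ?_
  rw [mul_assoc, C_mul']
  exact Submodule.smul_mem _ _ (graded_congr (graded_mul (W_mem i μ) (W_mem j μ)) rfl (zero_add 0))

theorem trilin_THH_mem_potentials {f : Symbols} (hf : f ∈ graded ![1, 2, 2] 1) :
    trilin THH f ∈ potentials := by
  refine graded_le (potentials.comap (trilin THH)) (fun s I hs hI => ?_) hf
  obtain ⟨α, h0⟩ := Multiset.card_eq_one.1 (hs 0)
  obtain ⟨μ, ν, h1⟩ := Multiset.card_eq_two.1 (hs 1)
  obtain ⟨ρ, σ, h2⟩ := Multiset.card_eq_two.1 (hs 2)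
  refine Submodule.subset_span ⟨.ut α, .h μ ν, .h ρ σ, I 0, I 1, I 2,
    .inl ⟨α, μ, ν, ρ, σ, rfl, rfl, rfl⟩, by rw [← hI, Fin.sum_univ_three], ?_⟩
  rw [trilin_slots, tri_apply, h0, h1, h2]
  simp only [show THH 0 = .T from rfl, show THH 1 = .H from rfl, show THH 2 = .H from rfl, fld_T,
    fld_H]
  rfl

theorem trilin_UTT_mem_potentials {f : Symbols} (hf : f ∈ graded ![1, 1, 1] 1) :
    trilin UTT f ∈ potentials := by
  refine graded_le (potentials.comap (trilin UTT)) (fun s I hs hI => ?_) hf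
  obtain ⟨α, h0⟩ := Multiset.card_eq_one.1 (hs 0)
  obtain ⟨μ, h1⟩ := Multiset.card_eq_one.1 (hs 1)
  obtain ⟨ν, h2⟩ := Multiset.card_eq_one.1 (hs 2)
  refine Submodule.subset_span ⟨.u α, .ut μ, .ut ν, I 0, I 1, I 2,
    .inr ⟨α, μ, ν, rfl, rfl, rfl⟩, by rw [← hI, Fin.sum_univ_three], ?_⟩
  rw [trilin_slots, tri_apply, h0, h1, h2]
  simp only [show UTT 0 = .U from rfl, show UTT 1 = .T from rfl, show UTT 2 = .T from rfl, fld_T,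
    fld_U]
  rfl

theorem potentialTHH_mem (i : Fin 17) : potentialTHH i ∈ graded ![1, 2, 2] 1 := by
  have hm (i j k l m n : Fin 3) (h : (Pi.single j 1 + (Pi.single k 1 + Pi.single l 1) +
      (Pi.single m 1 + Pi.single n 1) : Fin 3 → ℕ) = ![1, 2, 2]) (r : ℂ) :
      r • (pw i j * ww k l * ww m n) ∈ graded ![1, 2, 2] 1 := Submodule.smul_mem _ _
    (graded_congr (graded_mul (graded_mul (pw_mem i j) (ww_mem k l)) (ww_mem m n)) h rfl)
  have h1 := hm 1 1 0 1 2 2 (by decide)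
  have h2 := hm 0 1 0 1 2 2 (by decide)
  have h3 := hm 0 0 1 1 2 2 (by decide)
  have h4 := hm 0 1 0 2 1 2 (by decide)
  have h5 := hm 1 1 0 2 1 2 (by decide)
  have h6 := hm 0 0 1 2 1 2 (by decide)
  have z : (0 : Symbols) ∈ graded ![1, 2, 2] 1 := zero_mem _
  fin_cases i
  exacts [z, z, z, z, z, h1 _, z, add_mem (h2 _) (h1 _), h3 _, z, add_mem (h4 _) (h1 _), z, z,
    add_mem (h1 _) (h5 _), z, add_mem (h3 _) (h6 _), z]

theorem potentialUTT_mem (i : Fin 17) : potentialUTT i ∈ graded ![1, 1, 1] 1 := by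
  have hm (i j k l : Fin 3) (h : (Pi.single j 1 + (Pi.single k 1 + Pi.single l 1) : Fin 3 → ℕ) =
      ![1, 1, 1]) (r : ℂ) : r • (pw i j * ww k l) ∈ graded ![1, 1, 1] 1 :=
    Submodule.smul_mem _ _ (graded_congr (graded_mul (pw_mem i j) (ww_mem k l)) h rfl)
  have h1 := hm 1 0 1 2 (by decide)
  have h2 := hm 0 1 0 2 (by decide)
  have h3 := hm 1 1 0 2 (by decide)
  have z : (0 : Symbols) ∈ graded ![1, 1, 1] 1 := zero_mem _
  fin_cases i
  exacts [z, z, h1 _, z, h1 _, z, z, z, z, z, h1 _, add_mem (h2 _) (h3 _), h2 _, h2 _, z, z, h2 _]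

theorem exists_potential (i : Fin 17) :
    ∃ X ∈ potentials, coupling (v i) - dQ X ∈ divergences :=
  ⟨_, Submodule.smul_mem _ _ (add_mem (trilin_THH_mem_potentials (potentialTHH_mem i))
      (trilin_UTT_mem_potentials (potentialUTT_mem i))),
    coupling_sub_dQ_mem _ _ _ (balance_HHH i) (balance_UTH i)⟩

theorem v_mem_V (i : Fin 17) : v i ∈ V :=
  have ⟨_, _, hX⟩ := exists_potential i
  isGaugeInvariant_of_eq hX

theorem potentials_le_ghostNumber : potentials ≤ ghostNumber (-1) := by
  rw [potentials, Submodule.span_le]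
  rintro _ ⟨φ₁, φ₂, φ₃, I₁, I₂, I₃, hφ, -, rfl⟩
  refine Submodule.subset_span ⟨[⟨φ₁, I₁⟩, ⟨φ₂, I₂⟩, ⟨φ₃, I₃⟩], ?_, by simp [mul_assoc]⟩
  rcases hφ with ⟨α, μ, ν, ρ, σ, rfl, rfl, rfl⟩ | ⟨α, μ, ν, rfl, rfl, rfl⟩ <;>
    simp [Component.ghost]

/-! ### The conditions of gauge invariance -/

theorem sum_vEH (f : Fin 33 → Wick) : ∑ i, (vEH i : ℂ) • f i =
    -(1 / 4 : ℂ) • f 1 + (1 / 2 : ℂ) • f 7 + f 11 + (f 12 - f 14 - f 15 + f 30) := by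
  simp only [Fin.sum_univ_succ, Finset.univ_eq_empty, Finset.sum_empty, add_zero]
  simp [vEH]
  module

theorem coupling_vEH (κ : ℝ) : coupling (κ • vEH) = einsteinHilbert κ := by
  rw [coupling_smul, coupling, einsteinHilbert, sum_vEH, smul_add]
  rfl

/-- Four times the symbol of the gauge variation of an `hhh` product, up to the factor `i`. -/
def variationHHH : Symbols →ₗ[ℂ] Symbols :=
  qvary 0 + (perm s01).toLinearMap ∘ₗ (qvary 1 + (perm s12).toLinearMap ∘ₗ qvary 2)

theorem variationHHH_apply (f : Symbols) : variationHHH f =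
    qvary 0 f + (perm s01 (qvary 1 f) + perm s01 (perm s12 (qvary 2 f))) := by
  simp [variationHHH]

/-- The gauge variation of a coupling consists of a `uhh` part and a `uuũ` part. -/
theorem four_dQ_coupling (c : Fin 33 → ℝ) : (4 : ℂ) • dQ (coupling c) = Complex.I •
    (trilin UHH (variationHHH (symbolHHH fun i => (c i : ℂ)) -
        (4 : ℂ) • (pw 1 1 * symbolUTH fun i => (c i : ℂ))) -
      trilin UUT (perm s12 (qvary 2 (symbolUTH fun i => (c i : ℂ))))) := by
  rw [coupling_eq, map_add, dQ_trilin_HHH, dQ_trilin_UTH, variationHHH_apply]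
  simp only [vary_H_eq, map_add, map_sub, map_neg, map_smul]
  module

theorem smul_onShell (r : ℂ) (x : OnShell) : r • x = algebraMap ℂ OnShell r * x :=
  Algebra.smul_def r x

/-- The sum of a symbol over the exchange of the two tensor fields in `uhh`, on shell. -/
def symmetrizeUHH : Symbols →ₗ[ℂ] OnShell :=
  cls.toLinearMap ∘ₗ (LinearMap.id + (perm s12).toLinearMap)

theorem symmetrizeUHH_apply (f : Symbols) : symmetrizeUHH f = cls (f + perm s12 f) := rfl

/-- Linear forms in the parameters whose vanishing expresses that the `uhh` part of the gauge
variation of the coupling is a divergence. -/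
def constraint (c : Fin 33 → ℂ) : Fin 16 → ℂ := ![
  2 * c 0 + c 6 + 2 * c 18 + 2 * c 21,
  2 * c 3 + 2 * c 4 + c 8 + c 9 + 2 * c 12 + 2 * c 15,
  4 * c 1 - c 3 + c 4 - 2 * c 5 + 2 * c 7 + 2 * c 18 + 2 * c 22 - 2 * c 23,
  -4 * c 2 + 4 * c 3 + c 8 + c 9 - 2 * c 10 - 2 * c 11 + 2 * c 12 + 2 * c 13 + 4 * c 16 - 2 * c 17,
  4 * c 1 + 2 * c 7,
  4 * c 4 - 4 * c 5,
  4 * c 1 - 2 * c 4 + 2 * c 5 + 2 * c 7 + 2 * c 19 + 2 * c 22,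
  4 * c 1 + 2 * c 4 - 2 * c 5 + 2 * c 7,
  2 * c 3 + 2 * c 4 + 2 * c 8 + 2 * c 9 + 2 * c 13 - 2 * c 14 + 2 * c 15,
  2 * c 0 + c 3 - c 4 + 2 * c 5 + c 6 + 2 * c 19 - 2 * c 20 + 2 * c 21,
  -2 * c 6 - c 8 - c 9 + 2 * c 24 + 2 * c 27,
  -2 * c 6 - 2 * c 9 + 2 * c 10 + 2 * c 25 - 2 * c 26 + 2 * c 27 + 2 * c 31,
  -4 * c 7 - c 8 - c 9 + 2 * c 30,
  -4 * c 7 - 3 * c 8 - c 9 + 2 * c 11 + 2 * c 24 + 2 * c 28 - 2 * c 29,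
  -4 * c 7 - c 8 - 3 * c 9 + 2 * c 10 + 2 * c 25 + 2 * c 28 + 2 * c 30 + 2 * c 31 - 2 * c 32,
  -4 * c 7 - 2 * c 8 + 2 * c 11]

/-- The monomials of the `uhh` sector, symmetrized in the two tensor fields, as functions of the
contractions `p_i · w_j` and `w_i · w_j`. Momentum conservation eliminates `p_0`, and contractions
of two momenta vanish on shell. -/
def invariant {R : Type*} [CommRing R] (p w : Fin 3 → Fin 3 → R) : Fin 16 → R := ![
  p 1 0 * p 1 1 ^ 2 * w 2 2 + p 2 0 * p 2 2 ^ 2 * w 1 1,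
  p 1 0 * p 1 1 * p 1 2 * w 1 2 + p 2 0 * p 2 1 * p 2 2 * w 1 2,
  p 1 0 * p 1 1 * p 2 1 * w 2 2 + p 1 2 * p 2 0 * p 2 2 * w 1 1,
  p 1 0 * p 1 1 * p 2 2 * w 1 2 + p 1 1 * p 2 0 * p 2 2 * w 1 2,
  p 1 0 * p 1 2 ^ 2 * w 1 1 + p 2 0 * p 2 1 ^ 2 * w 2 2,
  p 1 0 * p 1 2 * p 2 1 * w 1 2 + p 1 2 * p 2 0 * p 2 1 * w 1 2,
  p 1 0 * p 1 2 * p 2 2 * w 1 1 + p 1 1 * p 2 0 * p 2 1 * w 2 2,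
  p 1 0 * p 2 1 ^ 2 * w 2 2 + p 1 2 ^ 2 * p 2 0 * w 1 1,
  p 1 0 * p 2 1 * p 2 2 * w 1 2 + p 1 1 * p 1 2 * p 2 0 * w 1 2,
  p 1 0 * p 2 2 ^ 2 * w 1 1 + p 1 1 ^ 2 * p 2 0 * w 2 2,
  p 1 1 ^ 2 * p 1 2 * w 0 2 + p 2 1 * p 2 2 ^ 2 * w 0 1,
  p 1 1 ^ 2 * p 2 2 * w 0 2 + p 1 1 * p 2 2 ^ 2 * w 0 1,
  p 1 1 * p 1 2 ^ 2 * w 0 1 + p 2 1 ^ 2 * p 2 2 * w 0 2,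
  p 1 1 * p 1 2 * p 2 1 * w 0 2 + p 1 2 * p 2 1 * p 2 2 * w 0 1,
  p 1 1 * p 1 2 * p 2 2 * w 0 1 + p 1 1 * p 2 1 * p 2 2 * w 0 2,
  p 1 2 ^ 2 * p 2 1 * w 0 1 + p 1 2 * p 2 1 ^ 2 * w 0 2]

set_option maxHeartbeats 1000000 in
set_option maxRecDepth 4000 in
/-- The `uhh` part of the gauge variation of the coupling, on shell. -/
theorem symmetrizeUHH_eq (c : Fin 33 → ℂ) :
    symmetrizeUHH (variationHHH (symbolHHH c) - (4 : ℂ) • (pw 1 1 * symbolUTH c)) =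
    2 * ∑ k, algebraMap ℂ OnShell (constraint c k) *
      invariant (fun i j => cls (pw i j)) (fun i j => cls (ww i j)) k := by
  simp [symbolHHH, symbolUTH, variationHHH_apply, symmetrizeUHH_apply, qvary_apply,
    lap_mul, grad_mul, grad_pw, grad_ww, lap_pw, lap_ww, dir_momentum_pw, dir_momentum_ww,
    dir_W_pw, dir_W_ww, perm_eight, cls_eight, mul_add, smul_add, Fin.sum_univ_succ,
    constraint, invariant]
  simp only [cls_pw_zero, cls_pp, ww_one_zero, ww_two_zero, ww_two_one, smul_onShell,
    algebraMap_two, algebraMap_three, algebraMap_four]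
  generalize cls (pw 1 0) = p₁₀, cls (pw 1 1) = p₁₁, cls (pw 1 2) = p₁₂,
    cls (pw 2 0) = p₂₀, cls (pw 2 1) = p₂₁, cls (pw 2 2) = p₂₂, cls (ww 0 0) = w₀₀,
    cls (ww 0 1) = w₀₁, cls (ww 0 2) = w₀₂, cls (ww 1 1) = w₁₁, cls (ww 1 2) = w₁₂,
    cls (ww 2 2) = w₂₂
  ring

theorem constraint_vEH : constraint (fun i => (vEH i : ℂ)) = 0 := by
  funext k
  fin_cases k <;> simp [constraint, vEH] <;> norm_num

/-- For the Einstein-Hilbert coupling the `uuũ` part of the gauge variation vanishes on shell after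
antisymmetrization in the two ghost fields. -/
theorem antisymm_vEH (f : Symbols)
    (hf : f = perm s12 (qvary 2 (symbolUTH fun i => (vEH i : ℂ)))) : cls (f - perm s01 f) = 0 := by
  rw [hf]
  simp [vEH, symbolUTH, qvary_apply, lap_mul, grad_mul, grad_pw, grad_ww, lap_pw,
    lap_ww, dir_momentum_pw, dir_momentum_ww, dir_W_pw, cls_pw_zero, cls_pp, ww_two_one]
  generalize cls (pw 1 0) = p₁₀, cls (pw 1 1) = p₁₁, cls (pw 1 2) = p₁₂,
    cls (pw 2 0) = p₂₀, cls (pw 2 1) = p₂₁, cls (pw 2 2) = p₂₂, cls (ww 0 0) = w₀₀,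
    cls (ww 0 1) = w₀₁, cls (ww 0 2) = w₀₂, cls (ww 1 1) = w₁₁, cls (ww 1 2) = w₁₂,
    cls (ww 2 2) = w₂₂
  ring

theorem vEH_mem_V : vEH ∈ V := by
  refine (isGaugeInvariant_iff _).2 (mem_of_four_smul_mem ?_)
  rw [four_dQ_coupling]
  refine divergences.smul_mem _ (sub_mem (trilin_UHH_mem ?_) (trilin_UUT_mem (antisymm_vEH _ rfl)))
  rw [← symmetrizeUHH_apply, symmetrizeUHH_eq, constraint_vEH]
  simp

/-! ### Evaluation at on-shell momenta -/

/-- The dual numbers `A[ε]`, with `x + y ε` encoded as `(x, y)`. A separate type keeps the instances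
of iterated dual numbers unambiguous. -/
def Dual (A : Type) : Type := A × A

namespace Dual

variable {A : Type} [CommRing A] [Algebra ℂ A]

instance : CommRing (Dual A) := inferInstanceAs (CommRing (TrivSqZeroExt A A))

instance : Algebra ℂ (Dual A) := inferInstanceAs (Algebra ℂ (TrivSqZeroExt A A))

/-- The nilpotent element `ε`. -/
def eps : Dual A := (0, 1)

/-- The inclusion of `A` into `A[ε]`. -/
def incl : A →ₐ[ℂ] Dual A := TrivSqZeroExt.inlAlgHom ℂ A A

/-- The coefficient of `ε`. -/
def coeff : Dual A →ₗ[ℂ] A := LinearMap.snd ℂ A A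

/-- The value at `ε = 0`. -/
def base : Dual A →ₐ[ℂ] A := TrivSqZeroExt.fstHom ℂ A A

@[ext] theorem ext {x y : Dual A} (h1 : base x = base y) (h2 : coeff x = coeff y) : x = y :=
  Prod.ext h1 h2

theorem coeff_mul (x y : Dual A) : coeff (x * y) = base x * coeff y + base y * coeff x := by
  refine (TrivSqZeroExt.snd_mul (R := A) (M := A) x y).trans ?_
  rw [op_smul_eq_smul]
  rfl

@[simp] theorem base_eps : base (eps : Dual A) = 0 := rfl
@[simp] theorem coeff_eps : coeff (eps : Dual A) = 1 := rfl
@[simp] theorem base_incl (x : A) : base (incl x) = x := rfl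
@[simp] theorem coeff_incl (x : A) : coeff (incl x) = 0 := rfl

/-- The extension of a derivation `d` of `A` to `A[ε]` with `ε ↦ c ε`. -/
def der (d : A →ₗ[ℂ] A) (c : ℂ) : Dual A →ₗ[ℂ] Dual A :=
  LinearMap.prodMap d (d + c • LinearMap.id)

@[simp] theorem base_der (d : A →ₗ[ℂ] A) (c : ℂ) (x : Dual A) : base (der d c x) = d (base x) := rfl

@[simp] theorem coeff_der (d : A →ₗ[ℂ] A) (c : ℂ) (x : Dual A) :
    coeff (der d c x) = d (coeff x) + c • coeff x := rfl

theorem der_mul {d : A →ₗ[ℂ] A} (hd : ∀ x y, d (x * y) = d x * y + x * d y) (c : ℂ)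
    (x y : Dual A) : der d c (x * y) = der d c x * y + x * der d c y := by
  ext
  · simp [hd]
  · simp [coeff_mul, hd, Algebra.smul_def]
    ring

theorem der_incl (d : A →ₗ[ℂ] A) (c : ℂ) (x : A) : der d c (incl x) = incl (d x) := by
  ext <;> simp

theorem der_eps {d : A →ₗ[ℂ] A} (hd : d 1 = 0) (c : ℂ) : der d c eps = c • eps := by
  ext <;> simp [hd]

theorem eps_mul_eps : (eps * eps : Dual A) = 0 := by
  ext <;> simp [coeff_mul]

end Dual

/-- The algebra `ℂ[ε₀, ε₁, ε₂]` with `εⱼ² = 0`. Its coefficient of `ε₀ ε₁ ε₂` extracts what is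
linear in each of three plane waves. -/
abbrev TripleDual : Type := Dual (Dual (Dual ℂ))

/-- The nilpotent generators `ε₀`, `ε₁`, `ε₂`. -/
def nilGen : Fin 3 → TripleDual := ![Dual.eps, Dual.incl Dual.eps, Dual.incl (Dual.incl Dual.eps)]

/-- The derivation with `εⱼ ↦ c j εⱼ`. -/
def weight (c : Fin 3 → ℂ) : TripleDual →ₗ[ℂ] TripleDual :=
  Dual.der (Dual.der (Dual.der 0 (c 2)) (c 1)) (c 0)

theorem weight_mul (c : Fin 3 → ℂ) (x y : TripleDual) :
    weight c (x * y) = weight c x * y + x * weight c y :=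
  Dual.der_mul (Dual.der_mul (Dual.der_mul (by simp) _) _) _ x y

/-- The coefficient of `ε₀ ε₁ ε₂`. -/
def topCoeff : TripleDual →ₗ[ℂ] ℂ := Dual.coeff ∘ₗ Dual.coeff ∘ₗ Dual.coeff

theorem apply_one_of_leibniz {A : Type} [CommRing A] [Algebra ℂ A] {d : A →ₗ[ℂ] A}
    (hd : ∀ x y, d (x * y) = d x * y + x * d y) : d 1 = 0 := by
  simpa using hd 1 1

theorem weight_nilGen (c : Fin 3 → ℂ) (j : Fin 3) : weight c (nilGen j) = c j • nilGen j := by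
  have h1 := Dual.der_mul (A := ℂ) (d := 0) (by simp) (c 2)
  have h2 := Dual.der_mul h1 (c 1)
  fin_cases j
  · exact Dual.der_eps (apply_one_of_leibniz h2) _
  · refine (Dual.der_incl _ _ _).trans ?_
    rw [Dual.der_eps (apply_one_of_leibniz h1)]
    exact map_smul _ _ _
  · refine (Dual.der_incl _ _ _).trans ?_
    rw [Dual.der_incl, Dual.der_eps (by simp), map_smul, map_smul]
    rfl

theorem topCoeff_weight (c : Fin 3 → ℂ) (x : TripleDual) :
    topCoeff (weight c x) = (∑ j, c j) * topCoeff x := by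
  simp [topCoeff, weight, Fin.sum_univ_three]
  ring

theorem nilGen_mul_self (j : Fin 3) : nilGen j * nilGen j = 0 := by
  fin_cases j
  · exact Dual.eps_mul_eps
  · exact (map_mul Dual.incl _ _).symm.trans (by rw [Dual.eps_mul_eps, map_zero])
  · refine (map_mul Dual.incl _ _).symm.trans ?_
    rw [← map_mul, Dual.eps_mul_eps, map_zero, map_zero]

theorem topCoeff_nilGen : topCoeff (nilGen 0 * nilGen 1 * nilGen 2) = 1 := by
  simp [topCoeff, nilGen, Dual.coeff_mul]

/-- The values of the fields: `u` is a plane wave with momentum `q 0`, polarization `e 0` and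
amplitude `ε₀`, `h` is a sum of two plane waves with amplitudes `ε₁` and `ε₂`, and `ũ` is zero. A
single nilpotent amplitude serves for `u` although `u` is a Fermi field: `ε₀² = 0` is all that the
anticommutation of `u` with itself requires. -/
def jetValue (q e : Fin 3 → Fin 4 → ℂ) : Jet → TripleDual
  | ⟨.h μ ν, I⟩ => (e 1 μ * e 1 ν * (I.map (q 1)).prod) • nilGen 1 +
      (e 2 μ * e 2 ν * (I.map (q 2)).prod) • nilGen 2
  | ⟨.u μ, I⟩ => (e 0 μ * (I.map (q 0)).prod) • nilGen 0
  | ⟨.ut _, _⟩ => 0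

/-- Momenta of sum zero that are null. -/
structure IsOnShell (q : Fin 3 → Fin 4 → ℂ) : Prop where
  sum_eq_zero : ∀ μ, ∑ j, q j μ = 0
  null : ∀ j, ∑ μ, eta μ * (q j μ * q j μ) = 0

theorem jetValue_rel {q e : Fin 3 → Fin 4 → ℂ} (hq : IsOnShell q) ⦃x y : FreeAlgebra ℂ Jet⦄
    (r : FieldRel x y) :
    FreeAlgebra.lift ℂ (jetValue q e) x = FreeAlgebra.lift ℂ (jetValue q e) y := by
  cases r with
  | symm μ ν I => simp [jetValue, mul_comm]
  | wave φ I =>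
    have key : ∀ j (r : ℂ),
        ∑ μ, eta μ * (r * (q j μ * (q j μ * (I.map (q j)).prod))) = 0 := by
      intro j r
      rw [← mul_zero (r * (I.map (q j)).prod), ← hq.null j, Finset.mul_sum]
      exact Finset.sum_congr rfl fun _ _ => by ring
    cases φ <;>
      simp [jetValue, Finset.sum_add_distrib, smul_smul, ← Finset.sum_smul, key]
  | comm a b =>
    obtain ⟨φ, I⟩ := a
    obtain ⟨ψ, J⟩ := b
    cases φ <;> cases ψ <;>
      simp [jetValue, Component.odd, sgn, nilGen_mul_self, mul_comm]

/-- The evaluation of Wick polynomials at the three plane waves. -/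
def evalHom {q : Fin 3 → Fin 4 → ℂ} (hq : IsOnShell q) (e : Fin 3 → Fin 4 → ℂ) :
    Wick →ₐ[ℂ] TripleDual :=
  RingQuot.liftAlgHom ℂ ⟨FreeAlgebra.lift ℂ (jetValue q e), jetValue_rel hq⟩

theorem evalHom_gen {q : Fin 3 → Fin 4 → ℂ} (hq : IsOnShell q) (e : Fin 3 → Fin 4 → ℂ) (a : Jet) :
    evalHom hq e (gen a) = jetValue q e a := by
  rw [evalHom, gen, RingQuot.liftAlgHom_mkAlgHom_apply, FreeAlgebra.lift_ι_apply]

/-- Partial derivatives act on plane waves as multiplication of each amplitude by its momentum. -/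
theorem evalHom_pd {q : Fin 3 → Fin 4 → ℂ} (hq : IsOnShell q) (e : Fin 3 → Fin 4 → ℂ) (μ : Fin 4)
    (F : Wick) : evalHom hq e (pd μ F) = weight (fun j => q j μ) (evalHom hq e F) := by
  induction F using wick_induction with
  | one =>
    have h1 := apply_one_of_leibniz (weight_mul fun j => q j μ)
    have h2 : pd μ 1 = 0 := gradedDerivation_one ..
    rw [h2, map_one, map_zero, h1]
  | smul r F h => simp only [map_smul, h]
  | add F G hF hG => simp only [map_add, hF, hG]
  | gen_mul a F h =>
    rw [pd_mul, map_add, map_mul, map_mul, h, map_mul, weight_mul, pd_gen, evalHom_gen, evalHom_gen]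
    congr 2
    obtain ⟨φ, I⟩ := a
    cases φ <;> simp [jetValue, weight_nilGen, smul_smul] <;> ring_nf

/-- Since the momenta add up to zero, the part linear in each plane wave vanishes for
divergences. -/
theorem topCoeff_evalHom_divergences {q : Fin 3 → Fin 4 → ℂ} (hq : IsOnShell q)
    (e : Fin 3 → Fin 4 → ℂ) {F : Wick} (hF : F ∈ divergences) : topCoeff (evalHom hq e F) = 0 := by
  obtain ⟨w, rfl⟩ := hF
  simp [divergence, evalHom_pd, topCoeff_weight, hq.sum_eq_zero]

/-- The evaluation of symbols at momenta `q` and polarizations `e`. -/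
def evalSym (q e : Fin 3 → Fin 4 → ℂ) : Symbols →ₐ[ℂ] ℂ :=
  aeval (Sum.elim (fun i => q i.1 i.2) fun i => e i.1 i.2)

theorem evalSym_P (q e : Fin 3 → Fin 4 → ℂ) (j : Fin 3) (μ : Fin 4) :
    evalSym q e (P j μ) = q j μ := aeval_X ..

theorem evalSym_W (q e : Fin 3 → Fin 4 → ℂ) (j : Fin 3) (μ : Fin 4) :
    evalSym q e (W j μ) = e j μ := aeval_X ..

theorem evalSym_C (q e : Fin 3 → Fin 4 → ℂ) (r : ℂ) : evalSym q e (C r) = r := aeval_C ..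

theorem evalSym_slots (q e : Fin 3 → Fin 4 → ℂ) (s I : Fin 3 → Multiset (Fin 4)) :
    evalSym q e (slots s I) = ∏ j, (((s j).map (e j)).prod * ((I j).map (q j)).prod) := by
  rw [slots_eq_prod, Fin.prod_univ_three]
  simp only [map_mul, map_multiset_prod, Multiset.map_map, comp_def, evalSym_W, evalSym_P]

theorem evalHom_trilin_UUT {q : Fin 3 → Fin 4 → ℂ} (hq : IsOnShell q) (e : Fin 3 → Fin 4 → ℂ)
    (f : Symbols) : evalHom hq e (trilin UUT f) = 0 := by
  have : (evalHom hq e).toLinearMap ∘ₗ trilin UUT = 0 := by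
    refine symbols_ext fun s I => ?_
    have h : evalHom hq e (fld .T (s 2) (I 2)) = 0 := by
      simp [fld, apply_ite, evalHom_gen, jetValue]
    simp only [LinearMap.comp_apply, trilin_slots, tri_apply, AlgHom.toLinearMap_apply, map_mul]
    rw [show UUT 2 = .T from rfl, h, mul_zero, LinearMap.zero_apply]
  exact LinearMap.congr_fun this f

theorem evalHom_trilin_UHH {q : Fin 3 → Fin 4 → ℂ} (hq : IsOnShell q) (e : Fin 3 → Fin 4 → ℂ)
    {n : ℕ} {f : Symbols} (hf : f ∈ graded ![1, 2, 2] n) :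
    topCoeff (evalHom hq e (trilin UHH f)) = evalSym q e (f + perm s12 f) := by
  suffices f ∈ LinearMap.eqLocus (topCoeff ∘ₗ (evalHom hq e).toLinearMap ∘ₗ trilin UHH)
    ((evalSym q e).toLinearMap ∘ₗ (LinearMap.id + (perm s12).toLinearMap)) from this
  refine graded_le _ (fun s I hs hI => ?_) hf
  obtain ⟨α, h0⟩ := Multiset.card_eq_one.1 (hs 0)
  obtain ⟨μ, ν, h1⟩ := Multiset.card_eq_two.1 (hs 1)
  obtain ⟨ρ, σ, h2⟩ := Multiset.card_eq_two.1 (hs 2)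
  have es : s12.symm = s12 := Equiv.symm_swap _ _
  simp only [LinearMap.mem_eqLocus, LinearMap.comp_apply, trilin_slots, tri_apply,
    AlgHom.toLinearMap_apply, LinearMap.add_apply, LinearMap.id_apply, map_add, perm_slots,
    evalSym_slots, Fin.prod_univ_three, comp_apply, es, s12_zero, s12_one, s12_two, h0, h1, h2,
    show UHH 0 = .U from rfl, show UHH 1 = .H from rfl, show UHH 2 = .H from rfl, fld_U, fld_H,
    map_mul, u, h, evalHom_gen, jetValue]
  have g1 : nilGen 1 * nilGen 1 = 0 := nilGen_mul_self 1
  have g2 : nilGen 2 * nilGen 2 = 0 := nilGen_mul_self 2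
  have : ∀ a b c d k : ℂ,
      a • nilGen 0 * (b • nilGen 1 + c • nilGen 2) * (d • nilGen 1 + k • nilGen 2) =
      (a * b * k + a * c * d) • (nilGen 0 * nilGen 1 * nilGen 2) := by
    intro a b c d k
    simp only [Algebra.smul_def, map_add, map_mul]
    generalize algebraMap ℂ TripleDual a = a, algebraMap ℂ TripleDual b = b,
      algebraMap ℂ TripleDual c = c, algebraMap ℂ TripleDual d = d, algebraMap ℂ TripleDual k = k
    linear_combination (a * b * d * nilGen 0) * g1 + (a * c * k * nilGen 0) * g2
  rw [this, map_smul, topCoeff_nilGen]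
  simp
  ring

/-- Truncated subtraction is harmless: a symbol of degree `0` in `w_j` has derivative `0`. -/
theorem pderiv_mem {d : Fin 3 → ℕ} {n : ℕ} (j : Fin 3) (ν : Fin 4) {f : Symbols}
    (hf : f ∈ graded d n) :
    pderiv (.inr (j, ν)) f ∈ graded (update d j (d j - 1)) n := by
  refine graded_le ((graded (update d j (d j - 1)) n).comap
    ((pderiv (.inr (j, ν)) : Derivation ℂ Symbols Symbols) : Symbols →ₗ[ℂ] Symbols))
    (fun s I hs hI => ?_) hf
  rw [Submodule.mem_comap, Derivation.coeFn_coe, pderiv_slots]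
  by_cases hν : ν ∈ s j
  · refine Submodule.smul_mem _ _ (slots_mem_graded (fun k => ?_) hI)
    rcases eq_or_ne k j with rfl | hk
    · rw [update_self, update_self, Multiset.card_erase_of_mem hν, hs, Nat.pred_eq_sub_one]
    · rw [update_of_ne hk, update_of_ne hk, hs]
  · rw [Multiset.count_eq_zero.2 hν, Nat.cast_zero, zero_smul]
    exact zero_mem _

theorem qvary_mem {d : Fin 3 → ℕ} {n : ℕ} (j : Fin 3) (hd : 2 ≤ d j) {f : Symbols}
    (hf : f ∈ graded d n) : qvary j f ∈ graded (update d j (d j - 1)) (n + 1) := by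
  have hdir : dir j (momentum j) f ∈ graded (update d j (d j - 1)) (n + 1) := by
    rw [dir_apply]
    refine Submodule.sum_mem _ fun μ _ => ?_
    rw [momentum, mul_assoc, C_mul']
    exact Submodule.smul_mem _ _ (graded_congr (graded_mul (P_mem j μ) (pderiv_mem j μ hf))
      (zero_add _) (add_comm _ _))
  have hlap : lap j f ∈ graded (update d j (d j - 2)) n := by
    rw [lap, LinearMap.sum_apply]
    refine Submodule.sum_mem _ fun μ _ => Submodule.smul_mem _ _ ?_
    have := pderiv_mem j μ (pderiv_mem j μ hf)
    rwa [update_self, update_idem] at this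
  have e : Pi.single j 1 + update d j (d j - 2) = update d j (d j - 1) := by
    funext k
    rcases eq_or_ne k j with rfl | hk
    · simp only [Pi.add_apply, update_self, Pi.single_eq_same]
      omega
    · simp [hk]
  rw [qvary_apply]
  exact sub_mem (graded_congr (graded_mul (pw_mem j j) hlap) e (add_comm _ _)) (add_mem hdir hdir)

theorem perm_mem {d : Fin 3 → ℕ} {n : ℕ} (σ : Equiv.Perm (Fin 3)) {f : Symbols}
    (hf : f ∈ graded d n) : perm σ f ∈ graded (d ∘ σ.symm) n := by
  refine graded_le ((graded (d ∘ σ.symm) n).comap (perm σ).toLinearMap) (fun s I hs hI => ?_) hf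
  rw [Submodule.mem_comap, AlgHom.toLinearMap_apply, perm_slots]
  exact slots_mem_graded (fun k => hs _) ((Equiv.sum_comp σ.symm _).trans hI)

theorem symbolHHH_mem (c : Fin 33 → ℂ) : symbolHHH c ∈ graded ![2, 2, 2] 2 := by
  unfold symbolHHH
  repeat' with_reducible apply add_mem
  all_goals
    apply Submodule.smul_mem
    apply graded_congr (graded_mul (graded_mul (graded_mul ?_ ?_) ?_) ?_) ?_ ?_
    any_goals with_reducible first | exact pw_mem _ _ | exact ww_mem _ _
    all_goals decide

theorem symbolUTH_mem (c : Fin 33 → ℂ) : symbolUTH c ∈ graded ![1, 1, 2] 2 := by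
  unfold symbolUTH
  repeat' with_reducible apply add_mem
  all_goals
    apply Submodule.smul_mem
    apply graded_congr (graded_mul (graded_mul ?_ ?_) ?_) ?_ ?_
    any_goals with_reducible first | exact pw_mem _ _ | exact ww_mem _ _
    all_goals decide

theorem variationHHH_sub_mem (c : Fin 33 → ℂ) :
    variationHHH (symbolHHH c) - (4 : ℂ) • (pw 1 1 * symbolUTH c) ∈ graded ![1, 2, 2] 3 := by
  have h0 := qvary_mem 0 (by decide) (symbolHHH_mem c)
  have h1 := perm_mem s01 (qvary_mem 1 (by decide) (symbolHHH_mem c))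
  have h2 := perm_mem s01 (perm_mem s12 (qvary_mem 2 (by decide) (symbolHHH_mem c)))
  have h3 := graded_mul (pw_mem 1 1) (symbolUTH_mem c)
  rw [show (Pi.single 1 1 + ![1, 1, 2] : Fin 3 → ℕ) = ![1, 2, 2] by decide] at h3
  rw [show (update ![2, 2, 2] 0 (![2, 2, 2] 0 - 1) : Fin 3 → ℕ) = ![1, 2, 2] by decide] at h0
  rw [show (update ![2, 2, 2] 1 (![2, 2, 2] 1 - 1) ∘ s01.symm : Fin 3 → ℕ) = ![1, 2, 2] by
    decide] at h1
  rw [show ((update ![2, 2, 2] 2 (![2, 2, 2] 2 - 1) ∘ s12.symm) ∘ s01.symm : Fin 3 → ℕ) =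
    ![1, 2, 2] by decide] at h2
  rw [variationHHH_apply]
  exact sub_mem (add_mem h0 (add_mem h1 h2)) (Submodule.smul_mem _ _ h3)

/-- The evaluation of symbols at on-shell momenta factors through the on-shell symbols. -/
def evalOnShell {q : Fin 3 → Fin 4 → ℂ} (hq : IsOnShell q) (e : Fin 3 → Fin 4 → ℂ) :
    OnShell →ₐ[ℂ] ℂ :=
  Ideal.Quotient.liftₐ kinematic (evalSym q e) fun f hf => by
    suffices kinematic ≤ RingHom.ker (evalSym q e) from this hf
    rw [kinematic, Ideal.span_le]
    rintro _ (⟨μ, rfl⟩ | ⟨j, rfl⟩)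
    · simpa [evalSym_P] using hq.sum_eq_zero μ
    · simpa [pp, evalSym_P, evalSym_C, mul_assoc] using hq.null j

theorem evalOnShell_cls {q : Fin 3 → Fin 4 → ℂ} (hq : IsOnShell q) (e : Fin 3 → Fin 4 → ℂ)
    (f : Symbols) : evalOnShell hq e (cls f) = evalSym q e f := rfl

theorem map_invariant {R S : Type*} [CommRing R] [CommRing S] (φ : R →+* S)
    (p w : Fin 3 → Fin 3 → R) (k : Fin 16) :
    φ (invariant p w k) = invariant (fun i j => φ (p i j)) (fun i j => φ (w i j)) k := by
  fin_cases k <;> simp [invariant]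

/-- A gauge invariant coupling satisfies a linear equation for each choice of on-shell momenta and
polarizations. -/
theorem sum_constraint_eq_zero {c : Fin 33 → ℝ} (hc : c ∈ V) {q : Fin 3 → Fin 4 → ℂ}
    (hq : IsOnShell q) (e : Fin 3 → Fin 4 → ℂ) :
    ∑ k, constraint (fun i => (c i : ℂ)) k * invariant (fun i j => evalSym q e (pw i j))
      (fun i j => evalSym q e (ww i j)) k = 0 := by
  have h1 := divergences.smul_mem (-(4 * Complex.I)) ((isGaugeInvariant_iff _).1 hc)
  have h2 := topCoeff_evalHom_divergences hq e h1
  have h3 := congrArg (evalOnShell hq e) (symmetrizeUHH_eq fun i => (c i : ℂ))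
  rw [symmetrizeUHH_apply, evalOnShell_cls,
    ← evalHom_trilin_UHH hq e (variationHHH_sub_mem fun i => (c i : ℂ))] at h3
  have h4 : (-(4 * Complex.I)) • dQ (coupling c) = (-Complex.I) • (4 : ℂ) • dQ (coupling c) := by
    module
  rw [h4, four_dQ_coupling, smul_smul, neg_mul, Complex.I_mul_I, neg_neg, one_smul, map_sub,
    evalHom_trilin_UUT, sub_zero, h3] at h2
  have two : evalOnShell hq e 2 = 2 := map_ofNat _ 2
  rw [map_mul, two, mul_eq_zero, or_iff_right two_ne_zero, map_sum] at h2
  rw [← h2]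
  refine Finset.sum_congr rfl fun k _ => ?_
  have h5 := map_invariant (evalOnShell hq e : OnShell →+* ℂ) (fun i j => cls (pw i j))
    (fun i j => cls (ww i j)) k
  simp only [RingHom.coe_coe, evalOnShell_cls] at h5
  rw [map_mul, AlgHom.commutes, h5]
  rfl

/-! ### The necessary conditions -/

/-- Three null momenta of sum zero, with the last two linearly independent. Such momenta are
parallel over the reals, so that complex ones are needed. -/
def nullMomenta : Fin 3 → Fin 4 → ℂ :=
  ![![-1, -1, -1, -Complex.I], ![1, 1, 0, 0], ![0, 0, 1, Complex.I]]

theorem isOnShell_nullMomenta : IsOnShell nullMomenta where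
  sum_eq_zero μ := by fin_cases μ <;> simp [nullMomenta, Fin.sum_univ_three]
  null j := by fin_cases j <;> simp [nullMomenta, Fin.sum_univ_four, eta]

/-- The polarization vectors with `q₁ · w_j = x₁ j` and `q₂ · w_j = x₂ j`, where `y₁` and `y₂` are
the coordinates along `q₁` and `q₂`. The contractions `p_i · w_j` and `w_i · w_j` can thus be chosen
almost freely. -/
def nullPolarization (x₁ x₂ y₁ y₂ : Fin 3 → ℂ) (j : Fin 3) : Fin 4 → ℂ :=
  ![x₁ j / 2 + y₁ j, x₁ j / 2 - y₁ j, x₂ j / 2 - y₂ j, -Complex.I * (x₂ j / 2 + y₂ j)]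

theorem evalSym_pw (x₁ x₂ y₁ y₂ : Fin 3 → ℂ) (i j : Fin 3) :
    evalSym nullMomenta (nullPolarization x₁ x₂ y₁ y₂) (pw i j) =
      ![-x₁ j - x₂ j, x₁ j, x₂ j] i := by
  simp only [pw, Fin.sum_univ_four, map_add, map_mul, evalSym_P, evalSym_W]
  fin_cases i <;> simp [nullMomenta, nullPolarization]
  · linear_combination (x₂ j / 2 + y₂ j) * Complex.I_mul_I
  · linear_combination -(x₂ j / 2 + y₂ j) * Complex.I_mul_I

theorem evalSym_ww (x₁ x₂ y₁ y₂ : Fin 3 → ℂ) (i j : Fin 3) :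
    evalSym nullMomenta (nullPolarization x₁ x₂ y₁ y₂) (ww i j) =
      x₁ i * y₁ j + y₁ i * x₁ j + x₂ i * y₂ j + y₂ i * x₂ j := by
  simp only [ww, Fin.sum_univ_four, map_add, map_mul, evalSym_C, evalSym_W]
  simp [eta, nullPolarization]
  linear_combination -(x₂ i / 2 + y₂ i) * (x₂ j / 2 + y₂ j) * Complex.I_mul_I

/-- All constraints hold, as sixteen choices of polarizations give a nonsingular system of linear
equations for them. -/
theorem constraint_eq_zero {c : Fin 33 → ℝ} (hc : c ∈ V) : constraint (fun i => (c i : ℂ)) = 0 := by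
  have h (x₁ x₂ y₁ y₂ : Fin 3 → ℂ) := sum_constraint_eq_zero hc isOnShell_nullMomenta
    (nullPolarization x₁ x₂ y₁ y₂)
  simp only [evalSym_pw, evalSym_ww] at h
  generalize constraint (fun i => (c i : ℂ)) = l at h
  -- Each choice below makes all but very few of the sixteen invariants vanish.
  have h0 := h ![0, 0, 1] ![0, 1, 0] ![1, 0, 0] ![0, 0, 0]
  have h1 := h ![0, 1, 0] ![0, 0, 1] ![0, 0, 0] ![1, 0, 0]
  have h2 := h ![1, 0, 0] ![0, 1, 1] ![0, 0, 1] ![0, 0, 0]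
  have h3 := h ![0, 0, 1] ![1, 1, 0] ![0, 1, 0] ![0, 0, 0]
  have h4 := h ![1, 1, 0] ![0, 0, 1] ![0, 0, 0] ![0, 1, 0]
  have h5 := h ![1, 0, 0] ![0, 1, 1] ![0, 1, 0] ![0, 0, 0]
  have h6 := h ![0, 1, 0] ![1, 0, 1] ![0, 1, 0] ![0, 0, 0]
  have h7 := h ![0, 0, 1] ![1, 1, 0] ![0, 0, 1] ![0, 0, 0]
  have h8 := h ![0, 0, 1] ![1, -1, 0] ![0, 0, 0] ![1, 1, 0]
  have h9 := h ![1, 1, 0] ![0, 0, 1] ![-1, 1, 0] ![0, 0, 0]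
  have h10 := h ![1, 1, 1] ![0, 1, 0] ![0, 0, 0] ![0, 0, 1]
  have h11 := h ![0, 1, 1] ![1, 0, -1] ![0, 0, 1] ![1, 0, 1]
  have h12 := h ![1, 1, 1] ![-1, 1, -1] ![0, 0, 1] ![1, 1, 0]
  have h13 := h ![1, -1, 1] ![1, 1, 1] ![1, 0, 0] ![0, 1, -1]
  have h14 := h ![0, 1, -1] ![0, 0, 1] ![1, 0, 0] ![0, 0, 0]
  have h15 := h ![0, 0, 1] ![0, 1, -1] ![0, 0, 0] ![1, 0, 0]
  simp [Fin.sum_univ_succ, invariant] at h0 h1 h2 h3 h4 h5 h6 h7 h8 h9 h10 h11 h12 h13 h14 h15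
  funext k
  fin_cases k
  · exact h6
  · change l 1 = 0
    linear_combination h10 - h3
  · change l 2 = 0
    linear_combination h13 / 8 + h12 / 8
  · exact h4
  · exact h7
  · exact h3
  · change l 6 = 0
    linear_combination h13 / 8 - h12 / 8
  · exact h8
  · change l 8 = 0
    linear_combination h11 + h4
  · exact h9
  · exact h5
  · exact h1
  · exact h2
  · change l 13 = 0
    linear_combination h5 + h2 - h15
  · change l 14 = 0
    linear_combination h5 + h2 - h14
  · exact h0

/-! ### A basis of the space of gauge invariant couplings -/

/-- The coordinates with respect to `v₁, …, v₁₇, v_EH` of the parameters of a gauge invariant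
coupling. -/
def coordinates (c : Fin 33 → ℝ) : Fin 18 → ℝ := ![
  c 5,
  -2 * c 7 - c 10 + c 30,
  c 14 + c 30,
  c 15 + c 30,
  -1 / 2 * c 14 + 1 / 2 * c 17 - 1 / 2 * c 30,
  1 / 2 * c 14 - c 15 + c 16 - 1 / 2 * c 17 - 1 / 2 * c 30,
  -c 22,
  c 18 + c 20 + c 22,
  c 18 + c 21,
  -c 20,
  -2 * c 7 + c 30,
  c 32,
  c 25 - c 32,
  c 9 - c 10,
  -c 6 + c 27,
  c 6,
  -c 28,
  2 * c 7]

/-- The vectors `v₁, …, v₁₇, v_EH`. -/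
def basisVector : Fin 18 → Fin 33 → ℝ := Fin.snoc v vEH

theorem sum_smul_basisVector (g : Fin 18 → ℝ) : ∑ i, g i • basisVector i = ![
  -g 8 - 1 / 2 * g 15, -1 / 4 * g 17, -g 0 + g 5 - 3 / 2 * g 10 + 1 / 2 * g 13, -g 0 + 2 * g 7,
  g 0, g 0, g 15, 1 / 2 * g 17, g 1 + g 10 - g 13, -g 1 + g 10 + g 13, -g 1 + g 10,
  g 1 + g 10 - g 13 + g 17, -g 3 - 2 * g 7 + g 17, g 2 - g 3 - 2 * g 7 - 2 * g 10,
  g 2 - g 10 - g 17, g 3 - g 10 - g 17, g 3 + g 4 + g 5, g 2 + 2 * g 4, g 6 + g 7 + g 9, g 6,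
  -g 9, -g 6 - g 7 + g 8 - g 9, -g 6, g 9, g 10 - g 14, g 11 + g 12, g 11 + g 14 + g 16,
  g 14 + g 15, -g 16, -g 14 - g 16, g 10 + g 17, -g 12 + g 13 + g 16, g 11] := by
  rw [Fin.sum_univ_castSucc]
  simp only [basisVector, Fin.snoc_castSucc, Fin.snoc_last, Fin.sum_univ_succ, Finset.univ_eq_empty,
    Finset.sum_empty, v, vEH]
  simp
  repeat' constructor
  all_goals ring

set_option maxHeartbeats 1000000 in
/-- The constraints leave no freedom beyond the eighteen coordinates. -/
theorem sum_coordinates {c : Fin 33 → ℝ} (hc : c ∈ V) :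
    ∑ i, coordinates c i • basisVector i = c := by
  have h (k : Fin 16) := congrArg Complex.re (congrFun (constraint_eq_zero hc) k)
  have h0 := h 0
  have h1 := h 1
  have h2 := h 2
  have h3 := h 3
  have h4 := h 4
  have h5 := h 5
  have h6 := h 6
  have h7 := h 7
  have h8 := h 8
  have h9 := h 9
  have h10 := h 10
  have h11 := h 11
  have h12 := h 12
  have h13 := h 13
  have h14 := h 14
  have h15 := h 15
  clear h
  simp [constraint] at h0 h1 h2 h3 h4 h5 h6 h7 h8 h9 h10 h11 h12 h13 h14 h15
  rw [sum_smul_basisVector]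
  simp only [coordinates, Matrix.cons_val]
  funext j
  fin_cases j
  all_goals
    simp only [Fin.mk_zero, Fin.mk_one, Fin.reduceFinMk, Matrix.cons_val]
    try linarith

theorem coordinates_sum (g : Fin 18 → ℝ) : coordinates (∑ i, g i • basisVector i) = g := by
  rw [sum_smul_basisVector]
  funext j
  fin_cases j
  all_goals
    simp [coordinates]
    try ring

theorem basisVector_mem (i : Fin 18) : basisVector i ∈ V := by
  induction i using Fin.lastCases with
  | last => rw [basisVector, Fin.snoc_last]; exact vEH_mem_V
  | cast i => rw [basisVector, Fin.snoc_castSucc]; exact v_mem_V i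

/-- The basis `v₁, …, v₁₇, v_EH` of the space of gauge invariant couplings. -/
def basisV : Module.Basis (Fin 18) ℝ V :=
  .mk (v := fun i => ⟨basisVector i, basisVector_mem i⟩)
    (Fintype.linearIndependent_iff.2 fun g hg => by
      have := congrArg (fun x : V => coordinates x) hg
      simp only [Submodule.coe_sum, Submodule.coe_smul, coordinates_sum, Submodule.coe_zero] at this
      intro i
      rw [this]
      fin_cases i <;> simp [coordinates])
    fun c _ => by
      have : c = ∑ i, coordinates c i • (⟨basisVector i, basisVector_mem i⟩ : V) :=
        Subtype.ext (by simpa using (sum_coordinates c.2).symm)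
      rw [this]
      exact Submodule.sum_mem _ fun i _ =>
        Submodule.smul_mem _ _ (Submodule.subset_span (Set.mem_range_self i))

theorem basisV_apply (i : Fin 18) : (basisV i : Fin 33 → ℝ) = basisVector i := by
  rw [basisV, Module.Basis.mk_apply]

theorem physicallyEquivalent_einsteinHilbert {c : Fin 33 → ℝ} (hc : c ∈ V) :
    PhysicallyEquivalent (coupling c) (einsteinHilbert (coordinates c (Fin.last 17))) := by
  choose X hX hXW using exists_potential
  have hsum := sum_coordinates hc
  rw [Fin.sum_univ_castSucc] at hsum
  simp only [basisVector, Fin.snoc_castSucc, Fin.snoc_last] at hsum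
  have hcoupling : coupling c - einsteinHilbert (coordinates c (Fin.last 17)) =
      ∑ i : Fin 17, ((coordinates c i.castSucc : ℝ) : ℂ) • coupling (v i) := by
    rw [sub_eq_iff_eq_add, ← coupling_vEH]
    conv_lhs => rw [← hsum]
    rw [coupling_add]
    congr 1
    simp only [← coupling_smul]
    exact map_sum (AddMonoidHom.mk' coupling coupling_add) _ _
  have hmem : ∑ i : Fin 17, ((coordinates c i.castSucc : ℝ) : ℂ) • (coupling (v i) - dQ (X i)) ∈
      divergences := Submodule.sum_mem _ fun i _ => divergences.smul_mem _ (hXW i)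
  obtain ⟨w, hw⟩ := hmem
  refine ⟨∑ i : Fin 17, ((coordinates c i.castSucc : ℝ) : ℂ) • X i,
    Submodule.sum_mem _ fun i _ => Submodule.smul_mem _ _ (potentials_le_ghostNumber (hX i)), w, ?_⟩
  rw [hw, hcoupling, map_sum, ← Finset.sum_add_distrib]
  refine Finset.sum_congr rfl fun i _ => ?_
  rw [map_smul, ← smul_add, add_sub_cancel]

end SpinTwo

end

theorem proposition2 :
    (∀ c : Fin 33 → ℝ, SpinTwo.IsGaugeInvariant (SpinTwo.coupling c) →
      ∃ κ : ℝ, SpinTwo.PhysicallyEquivalent (SpinTwo.coupling c) (SpinTwo.einsteinHilbert κ)) ∧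
    (∃ b : Module.Basis (Fin 18) ℝ SpinTwo.V,
      (∀ i : Fin 17, (b i.castSucc : Fin 33 → ℝ) = SpinTwo.v i) ∧
      (b (Fin.last 17) : Fin 33 → ℝ) = SpinTwo.vEH) ∧
    SpinTwo.coupling SpinTwo.vEH = SpinTwo.einsteinHilbert 1 ∧
    (∀ i : Fin 17, ∃ X ∈ SpinTwo.potentials, ∃ W : Fin 4 → SpinTwo.Wick,
      SpinTwo.coupling (SpinTwo.v i) = SpinTwo.dQ X + SpinTwo.divergence W) := by
  refine ⟨fun c hc => ⟨_, SpinTwo.physicallyEquivalent_einsteinHilbert hc⟩, ⟨SpinTwo.basisV,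
    fun i => ?_, ?_⟩, ?_, fun i => ?_⟩
  · rw [SpinTwo.basisV_apply, SpinTwo.basisVector, Fin.snoc_castSucc]
  · rw [SpinTwo.basisV_apply, SpinTwo.basisVector, Fin.snoc_last]
  · rw [← SpinTwo.coupling_vEH, one_smul]
  · obtain ⟨X, hX, W, hW⟩ := SpinTwo.exists_potential i
    exact ⟨X, hX, W, by rw [hW, add_sub_cancel]⟩
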